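/- Let $\Gamma_\star$ be the star graph with $n\ge 1$ edges, each identified with $[0,\infty)$ and attached at $0$ to the common vertex, so that $L^2(\Gamma_\star)=\bigoplus_{j=1}^n L^2(0,\infty)$ and $W^{k,2}(\Gamma_\star)=\bigoplus_{j=1}^n W^{k,2}(0,\infty)$. Let $A,B\in\mathbb C^{n\times n}$ be such that the $n\times 2n$ matrix $(A,B)$ has rank $n$ and $AB^\dagger$ is self-adjoint, and let $H_\star$ be the self-adjoint operator $H_\star f=-f''$ (edgewise) on $L^2(\Gamma_\star)$ with domain $\{f\in W^{2,2}(\Gamma_\star): A f(0)+B f'(0)=0\}$, where $f(0),f'(0)\in\mathbb C^n$ are the vectors of boundary values. Let $P_D,P_N,P_R=I-P_D-P_N$ be the mutually orthogonal orthogonal projections on $\mathbb C^n$, and $\Lambda$ the invertible self-adjoint operator on $P_R\mathbb C^n$, such that the condition $AF+BF'=0$ on $F,F'\in\mathbb C^n$ is equivalent to $P_DF=0$, $P_NF'=0$, $P_RF'=\Lambda P_RF$. Let $D(\mathcal E_\star)=\{f\in W^{1,2}(\Gamma_\star): P_Df(0)=0\}$, let $(e^{-itH_\star})_{t\in\mathbb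 R}$ and $(e^{it\Delta_{\mathbb R}})_{t\in\mathbb R}$ be the strongly continuous unitary groups on $L^2(\Gamma_\star)$ and $L^2(\mathbb R)$ generated by $-iH_\star$ and by $i\Delta_{\mathbb R}$ (with domain $W^{2,2}(\mathbb R)$), and let $P_c=I-P_p$, where $P_p$ is the orthogonal projection of $L^2(\Gamma_\star)$ onto the closed linear span of the eigenfunctions of $H_\star$. Assume that there is no Robin coupling, i.e. $P_R=0$. Then $H_\star$ has exactly $n_+(AB^\dagger)$ eigenvalues counted with multiplicity, where $n_+(AB^\dagger)$ is the number of positive eigenvalues of $AB^\dagger$ with multiplicity. Let $(\lambda_l,\varphi_l)$, $1\le l\le n_+(AB^\dagger)$, be the eigencouples of $H_\star$, with $(\varphi_l)$ orthonormal and spanning all eigenfunctions. For every $v\in D(\mathcal E_\star)$ and every $t\in\mathbb R$, the function $e^{-itH_\star}v$ belongs to $W^{1,2}(\Gamma_\star)$ and $$\partial_x\big(e^{-itH_\star}v\big)=-\,e^{-itH_\star}P_c\,v'+2\,e^{it\Delta_{\mathbb R}}\widetilde{v'}+\sum_{l=1}^{n_+(AB^\dagger)}\langle v,\varphi_l\rangle\,e^{-it\lambda_l}\,\varphi_l'\qquad\text{in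 }L^2(\Gamma_\star),$$ where $\langle\cdot,\cdot\rangle$ is the inner product of $L^2(\Gamma_\star)$, linear in its first argument, $\widetilde{v'}=(\widetilde{v_1'},\dots,\widetilde{v_n'})$ is the edgewise extension of $v'$ by zero to $(-\infty,0)$, and the second term on the right is, on the $j$-th edge, the restriction of $2e^{it\Delta_{\mathbb R}}\widetilde{v_j'}$ to $(0,\infty)$. -/

import Mathlib

open MeasureTheory Set
open scoped ContDiff Matrix

noncomputable section

namespace StarGraph

/-! ### Weak derivatives and boundary values -/

/-- `g` is the weak derivative of `f` on the open set `Ω ⊆ ℝ` (for locally integrable `f`, `g`). -/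
def HasWeakDeriv (Ω : Set ℝ) (f g : ℝ → ℂ) : Prop :=
  ∀ φ : ℝ → ℝ, ContDiff ℝ ∞ φ → HasCompactSupport φ → tsupport φ ⊆ Ω →
    ∫ x in Ω, deriv φ x • f x = -∫ x in Ω, φ x • g x

/-- `L²(0, ∞)`, the square integrable functions on one edge. -/
abbrev L2Edge : Type := Lp ℂ 2 (volume.restrict (Ioi (0 : ℝ)))

/-- `L²(ℝ)`. -/
abbrev L2Line : Type := Lp ℂ 2 (volume : Measure ℝ)

/-- `L²(Γ⋆) = ⨁ⱼ L²(0, ∞)`, for the star graph with `n` edges. -/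
abbrev L2Star (n : ℕ) : Type := PiLp 2 (fun _ : Fin n => L2Edge)

/-- `a` is the value at the vertex of (the continuous version of) `f`. -/
def HasBoundaryValue (f : L2Edge) (a : ℂ) : Prop :=
  ∃ F : ℝ → ℂ, ContinuousOn F (Ici 0) ∧ f =ᵐ[volume.restrict (Ioi (0 : ℝ))] F ∧ F 0 = a

/-- `f ∈ W^{1,2}(Γ⋆)` with edgewise weak derivative `g`. -/
def IsDeriv {n : ℕ} (f g : L2Star n) : Prop :=
  ∀ j, HasWeakDeriv (Ioi 0) (f j) (g j)

/-- `a` is the vector of the values of `f` at the vertex along the `n` edges. -/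
def IsVertexValue {n : ℕ} (f : L2Star n) (a : Fin n → ℂ) : Prop :=
  ∀ j, HasBoundaryValue (f j) (a j)

/-! ### Basic facts about weak derivatives, so that the operators below are well defined -/

theorem integrable_test_smul {Ω : Set ℝ} {f : ℝ → ℂ} (hf : MemLp f 2 (volume.restrict Ω))
    {φ : ℝ → ℝ} (hφ : Continuous φ) (hc : HasCompactSupport φ) :
    Integrable (fun x => φ x • f x) (volume.restrict Ω) :=
  (hf.locallyIntegrable (by norm_num)).integrable_smul_left_of_hasCompactSupport hφ hc

theorem HasWeakDeriv.congr {Ω : Set ℝ} {f g f₁ g₁ : ℝ → ℂ} (h : HasWeakDeriv Ω f g)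
    (hf : f₁ =ᵐ[volume.restrict Ω] f) (hg : g₁ =ᵐ[volume.restrict Ω] g) :
    HasWeakDeriv Ω f₁ g₁ := by
  intro φ h1 h2 h3
  have e1 : ∫ x in Ω, deriv φ x • f₁ x = ∫ x in Ω, deriv φ x • f x :=
    integral_congr_ae (hf.mono fun x hx => by simp only [hx])
  have e2 : ∫ x in Ω, φ x • g₁ x = ∫ x in Ω, φ x • g x :=
    integral_congr_ae (hg.mono fun x hx => by simp only [hx])
  rw [e1, e2]
  exact h φ h1 h2 h3

theorem HasWeakDeriv.add {Ω : Set ℝ} {f g f₁ g₁ : ℝ → ℂ}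
    (hf : MemLp f 2 (volume.restrict Ω)) (hg : MemLp g 2 (volume.restrict Ω))
    (hf₁ : MemLp f₁ 2 (volume.restrict Ω)) (hg₁ : MemLp g₁ 2 (volume.restrict Ω))
    (h : HasWeakDeriv Ω f g) (h₁ : HasWeakDeriv Ω f₁ g₁) :
    HasWeakDeriv Ω (f + f₁) (g + g₁) := by
  intro φ k1 k2 k3
  have c' : Continuous (deriv φ) := k1.continuous_deriv (by simp)
  simp only [Pi.add_apply, smul_add]
  rw [integral_add (integrable_test_smul hf c' k2.deriv) (integrable_test_smul hf₁ c' k2.deriv),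
    integral_add (integrable_test_smul hg k1.continuous k2)
      (integrable_test_smul hg₁ k1.continuous k2), h φ k1 k2 k3, h₁ φ k1 k2 k3]
  ring

theorem HasWeakDeriv.const_smul {Ω : Set ℝ} {f g : ℝ → ℂ} (c : ℂ) (h : HasWeakDeriv Ω f g) :
    HasWeakDeriv Ω (c • f) (c • g) := by
  intro φ k1 k2 k3
  simp only [Pi.smul_apply, smul_comm _ c]
  rw [integral_smul, integral_smul, h φ k1 k2 k3, smul_neg]

theorem HasWeakDeriv.zero (Ω : Set ℝ) : HasWeakDeriv Ω 0 0 := by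
  intro φ _ _ _
  simp

theorem HasWeakDeriv.eq_zero {Ω : Set ℝ} (hΩ : IsOpen Ω) {f g : ℝ → ℂ}
    (hg : MemLp g 2 (volume.restrict Ω)) (h : HasWeakDeriv Ω f g)
    (hf : f =ᵐ[volume.restrict Ω] 0) : g =ᵐ[volume.restrict Ω] 0 := by
  have hl : LocallyIntegrableOn g Ω volume :=
    locallyIntegrableOn_of_locallyIntegrable_restrict (hg.locallyIntegrable (by norm_num))
  have key := hΩ.ae_eq_zero_of_integral_contDiff_smul_eq_zero hl (fun φ k1 k2 k3 => by
    have e : ∫ x, φ x • g x = ∫ x in Ω, φ x • g x := by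
      refine (setIntegral_eq_integral_of_forall_compl_eq_zero fun x hx => ?_).symm
      rw [image_eq_zero_of_notMem_tsupport fun hx' => hx (k3 hx'), zero_smul]
    have := (h.congr hf.symm Filter.EventuallyEq.rfl) φ k1 k2 k3
    rw [e]
    simpa using this)
  exact (ae_restrict_iff' hΩ.measurableSet).2 key

theorem HasBoundaryValue.add {f g : L2Edge} {a b : ℂ} (hf : HasBoundaryValue f a)
    (hg : HasBoundaryValue g b) : HasBoundaryValue (f + g) (a + b) := by
  obtain ⟨F, h1, h2, h3⟩ := hf
  obtain ⟨G, k1, k2, k3⟩ := hg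
  exact ⟨F + G, h1.add k1, (Lp.coeFn_add f g).trans (h2.add k2), by simp [h3, k3]⟩

theorem HasBoundaryValue.const_smul {f : L2Edge} {a : ℂ} (c : ℂ) (hf : HasBoundaryValue f a) :
    HasBoundaryValue (c • f) (c * a) := by
  obtain ⟨F, h1, h2, h3⟩ := hf
  exact ⟨c • F, h1.const_smul c, (Lp.coeFn_smul c f).trans (h2.const_smul c), by simp [h3]⟩

theorem HasBoundaryValue.zero : HasBoundaryValue 0 0 :=
  ⟨0, continuousOn_const, Lp.coeFn_zero _ _ _, rfl⟩

theorem IsDeriv.add {n : ℕ} {f g f₁ g₁ : L2Star n} (h : IsDeriv f g) (h₁ : IsDeriv f₁ g₁) :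
    IsDeriv (f + f₁) (g + g₁) := fun j =>
  ((h j).add (Lp.memLp _) (Lp.memLp _) (Lp.memLp _) (Lp.memLp _) (h₁ j)).congr
    (Lp.coeFn_add _ _) (Lp.coeFn_add _ _)

theorem IsDeriv.const_smul {n : ℕ} {f g : L2Star n} (c : ℂ) (h : IsDeriv f g) :
    IsDeriv (c • f) (c • g) := fun j =>
  ((h j).const_smul c).congr (Lp.coeFn_smul _ _) (Lp.coeFn_smul _ _)

theorem IsDeriv.zero {n : ℕ} : IsDeriv (0 : L2Star n) 0 := fun _ =>
  (HasWeakDeriv.zero _).congr (Lp.coeFn_zero _ _ _) (Lp.coeFn_zero _ _ _)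

theorem IsDeriv.eq_zero {n : ℕ} {g : L2Star n} (h : IsDeriv 0 g) : g = 0 := by
  ext1 j
  have := (h j).eq_zero isOpen_Ioi (Lp.memLp _) (Lp.coeFn_zero _ _ _)
  exact Lp.ext (this.trans (Lp.coeFn_zero _ _ _).symm)

/-! ### The Hamiltonian on the star graph and the free Laplacian on the line -/

/-- The graph of `H⋆ = -Δ(A, B)`: the pairs `(f, -f'')` with `f ∈ W^{2,2}(Γ⋆)` and
`A f(0) + B f'(0) = 0`. -/
def hamiltonianGraph {n : ℕ} (A B : Matrix (Fin n) (Fin n) ℂ) :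
    Submodule ℂ (L2Star n × L2Star n) where
  carrier := {p | ∃ (f' : L2Star n) (a b : Fin n → ℂ), IsDeriv p.1 f' ∧ IsDeriv f' (-p.2) ∧
    IsVertexValue p.1 a ∧ IsVertexValue f' b ∧ A *ᵥ a + B *ᵥ b = 0}
  add_mem' := by
    rintro ⟨f, g⟩ ⟨f₁, g₁⟩ ⟨f', a, b, h1, h2, h3, h4, h5⟩ ⟨f₁', a₁, b₁, k1, k2, k3, k4, k5⟩
    refine ⟨f' + f₁', a + a₁, b + b₁, h1.add k1, ?_, fun j => (h3 j).add (k3 j),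
      fun j => (h4 j).add (k4 j), ?_⟩
    · have := h2.add k2
      rwa [← neg_add] at this
    · rw [Matrix.mulVec_add, Matrix.mulVec_add, add_add_add_comm, h5, k5, add_zero]
  zero_mem' := ⟨0, 0, 0, IsDeriv.zero, by simpa using IsDeriv.zero,
    fun _ => HasBoundaryValue.zero, fun _ => HasBoundaryValue.zero, by simp⟩
  smul_mem' := by
    rintro c ⟨f, g⟩ ⟨f', a, b, h1, h2, h3, h4, h5⟩
    refine ⟨c • f', c • a, c • b, h1.const_smul c, ?_, fun j => (h3 j).const_smul c,
      fun j => (h4 j).const_smul c, ?_⟩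
    · have := h2.const_smul c
      simpa [smul_neg] using this
    · rw [Matrix.mulVec_smul, Matrix.mulVec_smul, ← smul_add, h5, smul_zero]

/-- The Hamiltonian `H⋆ = -Δ(A, B)` on `L²(Γ⋆)`, an unbounded operator. -/
def hamiltonian {n : ℕ} (A B : Matrix (Fin n) (Fin n) ℂ) : L2Star n →ₗ.[ℂ] L2Star n :=
  (hamiltonianGraph A B).toLinearPMap

theorem hamiltonian_graph {n : ℕ} (A B : Matrix (Fin n) (Fin n) ℂ) :
    (hamiltonian A B).graph = hamiltonianGraph A B := by
  refine Submodule.toLinearPMap_graph_eq _ ?_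
  rintro ⟨f, g⟩ ⟨f', a, b, h1, h2, -⟩ hf
  simp only at hf h1 h2
  subst hf
  rw [h1.eq_zero] at h2
  simpa using h2.eq_zero

/-- The graph of the free Laplacian on `ℝ`: the pairs `(f, f'')` with `f ∈ W^{2,2}(ℝ)`. -/
def laplacianLineGraph : Submodule ℂ (L2Line × L2Line) where
  carrier := {p | ∃ f' : L2Line, HasWeakDeriv univ p.1 f' ∧ HasWeakDeriv univ f' p.2}
  add_mem' := by
    rintro ⟨f, g⟩ ⟨f₁, g₁⟩ ⟨f', h1, h2⟩ ⟨f₁', k1, k2⟩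
    have m : ∀ u : L2Line, MemLp u 2 (volume.restrict univ) := fun u => (Lp.memLp u).restrict _
    refine ⟨f' + f₁', (h1.add (m _) (m _) (m _) (m _) k1).congr ?_ ?_,
      (h2.add (m _) (m _) (m _) (m _) k2).congr ?_ ?_⟩ <;>
    exact ae_restrict_of_ae (Lp.coeFn_add _ _)
  zero_mem' := ⟨0, (HasWeakDeriv.zero _).congr (ae_restrict_of_ae (Lp.coeFn_zero _ _ _))
      (ae_restrict_of_ae (Lp.coeFn_zero _ _ _)),
    (HasWeakDeriv.zero _).congr (ae_restrict_of_ae (Lp.coeFn_zero _ _ _))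
      (ae_restrict_of_ae (Lp.coeFn_zero _ _ _))⟩
  smul_mem' := by
    rintro c ⟨f, g⟩ ⟨f', h1, h2⟩
    refine ⟨c • f', (h1.const_smul c).congr ?_ ?_, (h2.const_smul c).congr ?_ ?_⟩ <;>
    exact ae_restrict_of_ae (Lp.coeFn_smul _ _)

/-- The free Laplacian `Δ_ℝ` on `L²(ℝ)`, with domain `W^{2,2}(ℝ)`. -/
def laplacianLine : L2Line →ₗ.[ℂ] L2Line :=
  laplacianLineGraph.toLinearPMap

theorem laplacianLine_graph : laplacianLine.graph = laplacianLineGraph := by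
  refine Submodule.toLinearPMap_graph_eq _ ?_
  rintro ⟨f, g⟩ ⟨f', h1, h2⟩ hf
  have m : ∀ u : L2Line, MemLp u 2 (volume.restrict univ) := fun u => (Lp.memLp u).restrict _
  simp only at hf h1 h2
  subst hf
  have e1 := h1.eq_zero isOpen_univ (m _) (ae_restrict_of_ae (Lp.coeFn_zero _ _ _))
  have e2 := h2.eq_zero isOpen_univ (m _) e1
  rw [Measure.restrict_univ] at e2
  exact Lp.ext (e2.trans (Lp.coeFn_zero _ _ _).symm)

/-! ### Unitary groups -/

/-- `U` is a strongly continuous group of isometries whose infinitesimal generator is exactly `T`: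
`f` lies in the domain of `T` and `T f = g` if and only if `t ↦ U t f` has derivative `g` at `0`. -/
structure IsGroupGeneratedBy {E : Type*} [NormedAddCommGroup E] [NormedSpace ℂ E]
    (U : ℝ → E →L[ℂ] E) (T : E →ₗ.[ℂ] E) : Prop where
  map_zero : U 0 = 1
  map_add : ∀ s t, U (s + t) = U s * U t
  norm_map : ∀ t f, ‖U t f‖ = ‖f‖
  continuous : ∀ f, Continuous fun t => U t f
  generator : ∀ f g, (f, g) ∈ T.graph ↔ HasDerivAt (fun t => U t f) g 0

open Classical in
/-- The strongly continuous group of isometries `(e^{tT})_{t ∈ ℝ}` generated by `T`; it is unique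
when it exists, and it exists for `T = -iH` with `H` self-adjoint. -/
def expGroup {E : Type*} [NormedAddCommGroup E] [NormedSpace ℂ E] (T : E →ₗ.[ℂ] E) :
    ℝ → E →L[ℂ] E :=
  if h : ∃ U, IsGroupGeneratedBy U T then h.choose else 0

/-- `e^{-itH⋆}`. -/
def starGroup {n : ℕ} (A B : Matrix (Fin n) (Fin n) ℂ) : ℝ → L2Star n →L[ℂ] L2Star n :=
  expGroup ((-Complex.I) • hamiltonian A B)

/-- `e^{itΔ_ℝ}`. -/
def freeGroup : ℝ → L2Line →L[ℂ] L2Line :=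
  expGroup (Complex.I • laplacianLine)

/-! ### Extension by zero and the free group acting edge by edge -/

/-- The extension by zero of a function on `(0, ∞)` to `ℝ`. -/
def extendZero (f : L2Edge) : L2Line :=
  ((memLp_indicator_iff_restrict measurableSet_Ioi).2 (Lp.memLp f)).toLp ((Ioi (0 : ℝ)).indicator f)

/-- The restriction of a function on `ℝ` to `(0, ∞)`. -/
def restrictEdge (f : L2Line) : L2Edge :=
  ((Lp.memLp f).restrict (Ioi (0 : ℝ))).toLp f

/-- On every edge, the restriction to that edge of `e^{itΔ_ℝ}` applied to the extension by zero. -/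
def freeGroupOnEdges {n : ℕ} (t : ℝ) (f : L2Star n) : L2Star n :=
  WithLp.toLp 2 fun j => restrictEdge (freeGroup t (extendZero (f j)))

/-! ### Coupling conditions at the vertex -/

/-- The decomposition of the coupling condition `A F + B F' = 0` into its Dirichlet, Neumann and
Robin parts: mutually orthogonal orthogonal projections `PD`, `PN`, `PR` with sum `1`, and an
invertible self-adjoint operator `L` acting on the range of `PR` (encoded as a Hermitian matrix
that lives on this range). -/
structure CouplingParts {n : ℕ} (A B : Matrix (Fin n) (Fin n) ℂ) where
  PD : Matrix (Fin n) (Fin n) ℂ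
  PN : Matrix (Fin n) (Fin n) ℂ
  PR : Matrix (Fin n) (Fin n) ℂ
  L : Matrix (Fin n) (Fin n) ℂ
  projD : IsStarProjection PD
  projN : IsStarProjection PN
  projR : IsStarProjection PR
  orthDN : PD * PN = 0
  orthDR : PD * PR = 0
  orthNR : PN * PR = 0
  sum_eq : PR = 1 - PD - PN
  hermL : L.IsHermitian
  rangeL : PR * L * PR = L
  invL : ∃ K, PR * K * PR = K ∧ L * K = PR ∧ K * L = PR
  coupling : ∀ F F' : Fin n → ℂ, A *ᵥ F + B *ᵥ F' = 0 ↔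
    PD *ᵥ F = 0 ∧ PN *ᵥ F' = 0 ∧ PR *ᵥ F' = L *ᵥ (PR *ᵥ F)

/-- The form domain `D(E⋆) = {f ∈ W^{1,2}(Γ⋆) : PD f(0) = 0}`. -/
def formDomain {n : ℕ} (PD : Matrix (Fin n) (Fin n) ℂ) : Set (L2Star n) :=
  {f | (∃ f', IsDeriv f f') ∧ ∃ a, IsVertexValue f a ∧ PD *ᵥ a = 0}

/-! ### Eigenfunctions -/

/-- The eigenfunctions of an unbounded operator. -/
def eigenfunctions {E : Type*} [AddCommGroup E] [Module ℂ E] (T : E →ₗ.[ℂ] E) : Set E :=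
  {f | f ≠ 0 ∧ ∃ lam : ℂ, (f, lam • f) ∈ T.graph}

/-- `P_c = I - P_p`, with `P_p` the orthogonal projection onto the closed span of the
eigenfunctions. -/
def projC {E : Type*} [NormedAddCommGroup E] [InnerProductSpace ℂ E] [CompleteSpace E]
    (T : E →ₗ.[ℂ] E) : E →L[ℂ] E :=
  1 - (Submodule.span ℂ (eigenfunctions T)).topologicalClosure.starProjection

/-- `(lam l, φ l)` is a complete list of the eigencouples of `T`, counted with multiplicity: the
`φ l` are orthonormal eigenfunctions to the eigenvalues `lam l`, and they span all
eigenfunctions. -/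
structure IsEigencouples {E ι : Type*} [NormedAddCommGroup E] [InnerProductSpace ℂ E]
    (T : E →ₗ.[ℂ] E) (lam : ι → ℝ) (φ : ι → E) : Prop where
  orthonormal : Orthonormal ℂ φ
  eigen : ∀ l, (φ l, (lam l : ℂ) • φ l) ∈ T.graph
  complete : eigenfunctions T ⊆ Submodule.span ℂ (Set.range φ)

/-- `n₊(M)`, the number of positive eigenvalues of a Hermitian matrix, with multiplicity. -/
def numPosEigenvalues {n : ℕ} {M : Matrix (Fin n) (Fin n) ℂ} (hM : M.IsHermitian) : ℕ :=
  (Finset.univ.filter fun i => 0 < hM.eigenvalues i).card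

end StarGraph

end

noncomputable section

namespace StarGraph

open Filter Topology
open scoped SchwartzMap FourierTransform LineDeriv

/-! ### Strongly continuous groups: density of the domain and uniqueness -/

section Groups

variable {E : Type*} [NormedAddCommGroup E] [NormedSpace ℂ E] {T : E →ₗ.[ℂ] E}
  {U V : ℝ → E →L[ℂ] E}

/-! The proof is the reflection principle. Without Robin part, `S = P_N - P_D` is self-adjoint with
`S² = 1`, and the vertex condition reads `S f(0) = f(0)`, `-S f'(0) = f'(0)`. Extend `f` from the
star to `n` copies of the line by `f(-x) = S f(x)` (`unfold`). The two vertex conditions say exactly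
that neither the extension nor its derivative jumps at `0`, so `H⋆` becomes `-Δ_ℝ` acting on the
functions that obey the reflection rule (`mem_hamiltonianGraph_iff`). The free group commutes with
reflections and acts on each copy separately, hence preserves this rule. Therefore extending,
evolving freely and restricting is a group of isometries with generator `-iH⋆`
(`isGroupGeneratedBy_reflectedGroup`), and it is `e^{-itH⋆}` because a group is determined by its
generator.

Differentiation turns the rule for `S` into the rule for `-S`: if `v(0) = S v(0)`, the derivative of
the `S`-extension of `v` is the `-S`-extension of `v'`, which equals minus the `S`-extension of `v'`
plus twice its extension by zero. The free group commutes with the derivative, so evolving and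
restricting gives the first two terms of the formula (`isDeriv_reflectedGroup`).

The remaining terms are trivial. An eigenfunction of `H⋆` would unfold to an `L²` eigenfunction of
`Δ_ℝ`, and there is none, so `P_c = 1`. Moreover `A P_N = 0` and `B P_D = 0` force `AB† = 0`, so
`n₊(AB†) = 0` and the sum is empty.

On the line everything rests on Plancherel: weak derivatives become multiplication by `2πiξ`, and
`e^{itΔ}` becomes multiplication by a phase. On the half-line the tool is integration by parts with
a boundary term. -/

theorem IsGroupGeneratedBy.neg_apply_apply (hU : IsGroupGeneratedBy U T) (s : ℝ) (f : E) :
    U (-s) (U s f) = f := by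
  have := hU.map_add (-s) s
  rw [neg_add_cancel, hU.map_zero] at this
  exact (DFunLike.congr_fun this f).symm

theorem IsGroupGeneratedBy.apply_neg_apply (hU : IsGroupGeneratedBy U T) (s : ℝ) (f : E) :
    U s (U (-s) f) = f := by
  simpa using hU.neg_apply_apply (-s) f

theorem IsGroupGeneratedBy.add_apply (hU : IsGroupGeneratedBy U T) (s t : ℝ) (f : E) :
    U (s + t) f = U s (U t f) := by
  rw [hU.map_add]; rfl

/-- The group maps the domain of its generator to itself and commutes with the generator. -/
theorem IsGroupGeneratedBy.map_graph (hU : IsGroupGeneratedBy U T) {f g : E}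
    (h : (f, g) ∈ T.graph) (s : ℝ) : (U s f, U s g) ∈ T.graph := by
  rw [hU.generator] at h ⊢
  have := (((U s).restrictScalars ℝ).hasFDerivAt (x := U 0 f)).comp_hasDerivAt (0 : ℝ) h
  refine this.congr_of_eventuallyEq (Eventually.of_forall fun t => ?_)
  simp only [Function.comp_apply, ContinuousLinearMap.coe_restrictScalars']
  rw [← hU.add_apply, ← hU.add_apply, add_comm]

/-- The domain of the generator is dense. -/
theorem IsGroupGeneratedBy.dense_domain [CompleteSpace E] (hU : IsGroupGeneratedBy U T) :
    Dense {f : E | ∃ g, (f, g) ∈ T.graph} := by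
  intro x
  have hint : ∀ a b, IntervalIntegrable (fun s => U s x) volume a b := fun a b =>
    (hU.continuous x).intervalIntegrable a b
  have hprim : ∀ a b, HasDerivAt (fun u => ∫ s in a..u, U s x) (U b x) b := fun a b =>
    intervalIntegral.integral_hasDerivAt_right (hint a b)
      (hU.continuous x).aestronglyMeasurable.stronglyMeasurableAtFilter
      (hU.continuous x).continuousAt
  -- Time averages of an orbit lie in the domain: `U t` shifts the interval of integration, so the
  -- dependence on `t` is that of a difference of two primitives. Dividing by `h → 0` then recovers
  -- `x`.
  have hmem : ∀ h : ℝ, (∫ s in (0 : ℝ)..h, U s x) ∈ {f : E | ∃ g, (f, g) ∈ T.graph} := by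
    intro h
    refine ⟨U h x - U 0 x, (hU.generator _ _).2 ?_⟩
    have e : (fun t => U t (∫ s in (0 : ℝ)..h, U s x)) =
        fun t => (∫ s in (0 : ℝ)..(t + h), U s x) - ∫ s in (0 : ℝ)..t, U s x := by
      funext t
      rw [← ContinuousLinearMap.intervalIntegral_comp_comm _ (hint 0 h)]
      simp only [← hU.add_apply]
      rw [intervalIntegral.integral_comp_add_left (fun s => U s x) t, add_zero,
        intervalIntegral.integral_interval_sub_left (hint _ _) (hint _ _)]
    rw [e]
    refine HasDerivAt.sub ?_ (hprim 0 0)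
    have := (hprim 0 (0 + h)).comp_add_const (0 : ℝ) h
    simpa using this
  have hlim := (hprim 0 0).tendsto_slope_zero
  simp only [zero_add, intervalIntegral.integral_same, sub_zero, hU.map_zero,
    one_apply_eq_self] at hlim
  refine mem_closure_of_tendsto hlim (Eventually.of_forall fun h => ?_)
  obtain ⟨g, hg⟩ := hmem h
  have := T.graph.smul_mem ((h⁻¹ : ℝ) : ℂ) hg
  refine ⟨((h⁻¹ : ℝ) : ℂ) • g, ?_⟩
  rwa [← Complex.coe_smul h⁻¹ (∫ s in (0 : ℝ)..h, U s x)]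

/-- A strongly continuous group of isometries is determined by its generator. -/
theorem IsGroupGeneratedBy.unique [CompleteSpace E] (hU : IsGroupGeneratedBy U T)
    (hV : IsGroupGeneratedBy V T) : U = V := by
  have key : ∀ f ∈ {f : E | ∃ g, (f, g) ∈ T.graph}, ∀ t, U (-t) (V t f) = f := by
    rintro f ⟨g, hfg⟩ t
    have hd : ∀ s, HasDerivAt (fun s => U (-s) (V s f)) 0 s := by
      intro s
      have hz : HasDerivAt (fun h => V h (V s f) - U h (V s f)) 0 0 := by
        have h1 := (hV.generator _ _).1 (hV.map_graph hfg s)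
        have h2 := (hU.generator _ _).1 (hV.map_graph hfg s)
        have := h1.sub h2
        rwa [sub_self] at this
      -- With `w = V s f`, the increment is `U (-s) (U (-h) (V h w - U h w))`. The isometries drop
      -- out of its norm, and `V h w - U h w = o(h)` because both orbits have the same derivative at
      -- `0`.
      rw [hasDerivAt_iff_isLittleO_nhds_zero] at hz ⊢
      refine Asymptotics.IsLittleO.of_norm_left (hz.norm_left.congr_left fun h => ?_)
      have e1 : U (-(s + h)) (V (s + h) f) = U (-s) (U (-h) (V h (V s f))) := by
        rw [← hV.add_apply, ← hU.add_apply, add_comm h s, neg_add]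
      have e2 : U (-s) (V s f) = U (-s) (U (-h) (U h (V s f))) := by
        rw [hU.neg_apply_apply]
      rw [e1, e2, ← map_sub, ← map_sub, smul_zero, sub_zero, sub_zero, hU.norm_map, hU.norm_map, zero_add,
        hV.map_zero, hU.map_zero]
      simp
    have := is_const_of_deriv_eq_zero (fun s => (hd s).differentiableAt)
      (fun s => (hd s).deriv) t 0
    simpa [hU.map_zero, hV.map_zero] using this
  funext t
  ext f
  have heq : ∀ f, U (-t) (V t f) = f := fun f => by
    refine congrFun (Continuous.ext_on hU.dense_domain
      ((U (-t)).continuous.comp (V t).continuous) continuous_id ?_) f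
    exact fun f hf => key f hf t
  rw [← hU.apply_neg_apply t (V t f), heq]

theorem isGroupGeneratedBy_expGroup (hU : IsGroupGeneratedBy U T) :
    IsGroupGeneratedBy (expGroup T) T := by
  have h : ∃ U, IsGroupGeneratedBy U T := ⟨U, hU⟩
  rw [expGroup, dif_pos h]
  exact h.choose_spec

/-- By uniqueness the choice in `expGroup` is harmless, so any explicit group with the right
generator may be computed with instead. -/
theorem expGroup_eq [CompleteSpace E] (hU : IsGroupGeneratedBy U T) : expGroup T = U :=
  (isGroupGeneratedBy_expGroup hU).unique hU

/-- The curve `u` has derivative `g` at `0`, in terms of complex scalars only. -/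
def HasSlopeLimit (u : ℝ → E) (g : E) : Prop :=
  Tendsto (fun t : ℝ => ((t⁻¹ : ℝ) : ℂ) • (u t - u 0)) (𝓝[≠] 0) (𝓝 g)

theorem hasSlopeLimit_iff_hasDerivAt {u : ℝ → E} {g : E} :
    HasSlopeLimit u g ↔ HasDerivAt u g 0 := by
  rw [hasDerivAt_iff_tendsto_slope_zero]
  simp only [zero_add]
  rfl

theorem HasSlopeLimit.map {F : Type*} [NormedAddCommGroup F] [NormedSpace ℂ F] {u : ℝ → E} {g : E}
    (h : HasSlopeLimit u g) (J : E →L[ℂ] F) : HasSlopeLimit (fun t => J (u t)) (J g) := by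
  have := (J.continuous.tendsto g).comp h
  simpa only [HasSlopeLimit, Function.comp_def, map_smul, map_sub] using this

end Groups

/-! ### The unitary group of a real multiplication operator on `L²` -/

section PhaseMul

variable {α : Type*} [MeasurableSpace α] {μ : Measure α}

theorem norm_sq_eq_integral_norm_sq (u : Lp ℂ 2 μ) : ‖u‖ ^ 2 = ∫ x, ‖u x‖ ^ 2 ∂μ := by
  rw [← inner_self_eq_norm_sq (𝕜 := ℂ), L2.inner_def, ← integral_re (L2.integrable_inner u u)]
  simp only [inner_self_eq_norm_sq]

/-- Dominated convergence in `L²`. -/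
theorem tendsto_Lp_of_dominated {ι : Type*} {l : Filter ι} [l.IsCountablyGenerated]
    {F : ι → Lp ℂ 2 μ} {f : Lp ℂ 2 μ} {b : α → ℝ} (hb : MemLp b 2 μ)
    (hF : ∀ᶠ i in l, ∀ᵐ x ∂μ, ‖F i x - f x‖ ≤ b x) {G : ι → α → ℂ} (hG : ∀ i, F i =ᵐ[μ] G i)
    (hlim : ∀ᵐ x ∂μ, Tendsto (fun i => G i x) l (𝓝 (f x))) : Tendsto F l (𝓝 f) := by
  -- The pointwise limit is taken along the representatives `G i`: each `F i` is only a class, and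
  -- for an uncountable index the exceptional null sets need not have a null union.
  have key : Tendsto (fun i => ∫ x, ‖G i x - f x‖ ^ 2 ∂μ) l (𝓝 (∫ _, (0 : ℝ) ∂μ)) := by
    refine tendsto_integral_filter_of_dominated_convergence (fun x => b x ^ 2) ?_ ?_
      hb.integrable_sq ?_
    · refine Eventually.of_forall fun i => ?_
      exact ((((Lp.aestronglyMeasurable _).congr (hG i)).sub (Lp.aestronglyMeasurable f)).norm).pow 2
    · filter_upwards [hF] with i hi
      filter_upwards [hi, hG i] with x hx hGx
      rw [← hGx, Real.norm_of_nonneg (by positivity)]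
      exact pow_le_pow_left₀ (norm_nonneg _) hx 2
    · filter_upwards [hlim] with x hx
      have := ((hx.sub_const (f x)).norm).pow 2
      simpa using this
  rw [tendsto_iff_norm_sub_tendsto_zero]
  have e : ∀ i, ‖F i - f‖ ^ 2 = ∫ x, ‖G i x - f x‖ ^ 2 ∂μ := fun i => by
    rw [norm_sq_eq_integral_norm_sq]
    refine integral_congr_ae ?_
    filter_upwards [hG i, Lp.coeFn_sub (F i) f] with x h1 h2
    rw [h2, Pi.sub_apply, h1]
  simp only [← e, integral_zero] at key
  have := key.sqrt
  simpa [Real.sqrt_sq (norm_nonneg _)] using this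

theorem memLp_phase_mul {m : α → ℝ} (hm : Measurable m) (t : ℝ) {f : α → ℂ} (hf : MemLp f 2 μ) :
    MemLp (fun x => Complex.exp (Complex.I * ((t * m x : ℝ) : ℂ)) * f x) 2 μ := by
  refine hf.of_le (AEStronglyMeasurable.mul ?_ hf.1) (Eventually.of_forall fun x => ?_)
  · exact (by fun_prop : Measurable fun x => Complex.exp (Complex.I * ((t * m x : ℝ) : ℂ))).aestronglyMeasurable
  · rw [norm_mul, Complex.norm_exp_I_mul_ofReal, one_mul]

/-- Multiplication by `exp (i t m)` on `L²`. -/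
def phaseMul (μ : Measure α) {m : α → ℝ} (hm : Measurable m) (t : ℝ) :
    Lp ℂ 2 μ →ₗᵢ[ℂ] Lp ℂ 2 μ where
  toFun f := (memLp_phase_mul hm t (Lp.memLp f)).toLp _
  map_add' f g := by
    refine Lp.ext ?_
    filter_upwards [MemLp.coeFn_toLp (memLp_phase_mul hm t (Lp.memLp (f + g))),
      MemLp.coeFn_toLp (memLp_phase_mul hm t (Lp.memLp f)),
      MemLp.coeFn_toLp (memLp_phase_mul hm t (Lp.memLp g)), Lp.coeFn_add f g,
      Lp.coeFn_add ((memLp_phase_mul hm t (Lp.memLp f)).toLp _)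
        ((memLp_phase_mul hm t (Lp.memLp g)).toLp _)] with x h1 h2 h3 h4 h5
    rw [h1, h5, Pi.add_apply, h2, h3, h4, Pi.add_apply, mul_add]
  map_smul' c f := by
    refine Lp.ext ?_
    filter_upwards [MemLp.coeFn_toLp (memLp_phase_mul hm t (Lp.memLp (c • f))),
      MemLp.coeFn_toLp (memLp_phase_mul hm t (Lp.memLp f)), Lp.coeFn_smul c f,
      Lp.coeFn_smul c ((memLp_phase_mul hm t (Lp.memLp f)).toLp _)] with x h1 h2 h3 h4
    rw [RingHom.id_apply, h1, h4, Pi.smul_apply, h2, h3, Pi.smul_apply, smul_eq_mul, smul_eq_mul]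
    ring
  norm_map' f := by
    change ‖(memLp_phase_mul hm t (Lp.memLp f)).toLp _‖ = ‖f‖
    rw [Lp.norm_toLp, Lp.norm_def]
    congr 1
    refine eLpNorm_congr_norm_ae (Eventually.of_forall fun x => ?_)
    rw [norm_mul, Complex.norm_exp_I_mul_ofReal, one_mul]

theorem coeFn_phaseMul {m : α → ℝ} (hm : Measurable m) (t : ℝ) (f : Lp ℂ 2 μ) :
    phaseMul μ hm t f =ᵐ[μ] fun x => Complex.exp (Complex.I * ((t * m x : ℝ) : ℂ)) * f x :=
  MemLp.coeFn_toLp (memLp_phase_mul hm t (Lp.memLp f))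

theorem phaseMul_zero {m : α → ℝ} (hm : Measurable m) (f : Lp ℂ 2 μ) : phaseMul μ hm 0 f = f := by
  refine Lp.ext ?_
  filter_upwards [coeFn_phaseMul hm 0 f] with x h1
  simp [h1]

theorem phaseMul_add {m : α → ℝ} (hm : Measurable m) (s t : ℝ) (f : Lp ℂ 2 μ) :
    phaseMul μ hm (s + t) f = phaseMul μ hm s (phaseMul μ hm t f) := by
  refine Lp.ext ?_
  filter_upwards [coeFn_phaseMul hm (s + t) f, coeFn_phaseMul hm t f,
    coeFn_phaseMul hm s (phaseMul μ hm t f)] with x h1 h2 h3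
  rw [h1, h3, h2, ← mul_assoc, ← Complex.exp_add]
  congr 2
  push_cast
  ring

theorem continuous_phaseMul {m : α → ℝ} (hm : Measurable m) (f : Lp ℂ 2 μ) :
    Continuous fun t => phaseMul μ hm t f := by
  refine continuous_iff_continuousAt.2 fun t₀ => ?_
  refine tendsto_Lp_of_dominated (b := fun x => 2 * ‖f x‖) ((Lp.memLp f).norm.const_mul 2) ?_
    (fun t => coeFn_phaseMul hm t f) ?_
  · refine Eventually.of_forall fun t => ?_
    filter_upwards [coeFn_phaseMul hm t f, coeFn_phaseMul hm t₀ f] with x h1 h2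
    refine (norm_sub_le _ _).trans_eq ?_
    rw [h1, h2, norm_mul, norm_mul, Complex.norm_exp_I_mul_ofReal, Complex.norm_exp_I_mul_ofReal]
    ring
  · filter_upwards [coeFn_phaseMul hm t₀ f] with x h1
    rw [h1]
    exact (by fun_prop : Continuous fun t : ℝ =>
      Complex.exp (Complex.I * ((t * m x : ℝ) : ℂ)) * f x).tendsto t₀

/-- The generator is multiplication by `i m` on its maximal domain. If the difference quotients
converge in `L²`, a sequence of them converges almost everywhere, and the limit must be the
pointwise derivative `i m f`. Conversely `|exp (i s) - 1| ≤ |s|` bounds the quotients by `|m f| =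
|g|`, and dominated convergence applies. -/
theorem hasSlopeLimit_phaseMul_iff {m : α → ℝ} (hm : Measurable m) (f g : Lp ℂ 2 μ) :
    HasSlopeLimit (fun t => phaseMul μ hm t f) g ↔ g =ᵐ[μ] fun x => Complex.I * m x * f x := by
  rw [HasSlopeLimit]
  set G : ℝ → α → ℂ := fun t x => ((t⁻¹ : ℝ) : ℂ) • (Complex.exp (Complex.I * ((t * m x : ℝ) : ℂ)) * f x - f x)
    with hG
  have hcoe : ∀ t : ℝ, (((t⁻¹ : ℝ) : ℂ) • (phaseMul μ hm t f - phaseMul μ hm 0 f) : Lp ℂ 2 μ)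
      =ᵐ[μ] G t := fun t => by
    rw [phaseMul_zero]
    filter_upwards [coeFn_phaseMul hm t f, Lp.coeFn_sub (phaseMul μ hm t f) f,
      Lp.coeFn_smul ((t⁻¹ : ℝ) : ℂ) (phaseMul μ hm t f - f)] with x h1 h2 h3
    rw [h3, Pi.smul_apply, h2, Pi.sub_apply, h1]
  have hlim : ∀ x, Tendsto (fun t => G t x) (𝓝[≠] 0) (𝓝 (Complex.I * m x * f x)) := fun x => by
    have hd : HasDerivAt (fun t : ℝ => Complex.exp (Complex.I * ((t * m x : ℝ) : ℂ)) * f x)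
        (Complex.I * m x * f x) 0 := by
      have h1 : HasDerivAt (fun t : ℝ => Complex.I * ((t * m x : ℝ) : ℂ))
          (Complex.I * ((1 * m x : ℝ) : ℂ)) 0 :=
        (((hasDerivAt_id (0 : ℝ)).mul_const (m x)).ofReal_comp).const_mul Complex.I
      have := (h1.cexp).mul_const (f x)
      simpa using this
    simpa [hG] using hd.tendsto_slope_zero
  constructor
  · intro h
    obtain ⟨ns, hns, hae⟩ := (tendstoInMeasure_of_tendsto_Lp h).exists_seq_tendsto_ae'
    have hall : ∀ᵐ x ∂μ, ∀ k, (((((ns k)⁻¹ : ℝ) : ℂ) • (phaseMul μ hm (ns k) f - phaseMul μ hm 0 f) :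
        Lp ℂ 2 μ) : α → ℂ) x = G (ns k) x := ae_all_iff.2 fun k => hcoe (ns k)
    filter_upwards [hae, hall] with x h1 h2
    simp only [h2] at h1
    exact tendsto_nhds_unique h1 ((hlim x).comp hns)
  · intro h
    refine tendsto_Lp_of_dominated (b := fun x => 2 * ‖g x‖) ((Lp.memLp g).norm.const_mul 2) ?_
      hcoe ?_
    · filter_upwards [self_mem_nhdsWithin] with t ht
      filter_upwards [hcoe t, h] with x h1 h2
      refine (norm_sub_le _ _).trans ?_
      rw [h1, two_mul]
      refine add_le_add_left ?_ _
      rw [h2, hG]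
      simp only
      rw [← sub_one_mul, norm_smul, norm_mul, norm_mul, norm_mul, Complex.norm_I, one_mul, ← mul_assoc,
        Complex.norm_real]
      refine mul_le_mul_of_nonneg_right ?_ (norm_nonneg _)
      have := Real.norm_exp_I_mul_ofReal_sub_one_le (x := t * m x)
      rw [Complex.norm_real, norm_inv, inv_mul_le_iff₀ (norm_pos_iff.2 ht), ← norm_mul]
      exact this
    · filter_upwards [h] with x hx
      rw [hx]
      exact hlim x

end PhaseMul

/-! ### Weak derivatives on the line and the Fourier transform -/

section LineFourier

/-- The compact support of test functions is removed by the cutoffs `χ(εx)` with `ε = 1/(N+1) → 0`.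
The extra term of the product rule carries a factor `ε` and vanishes in the limit. -/
theorem HasWeakDeriv.integral_of_memLp {f g : ℝ → ℂ} (hf : MemLp f 2 volume)
    (hg : MemLp g 2 volume) (h : HasWeakDeriv univ f g) {ψ : ℝ → ℝ} (hψ : ContDiff ℝ ∞ ψ)
    (hψ₂ : MemLp ψ 2 volume) (hψ' : MemLp (deriv ψ) 2 volume) :
    ∫ x, deriv ψ x • f x = -∫ x, ψ x • g x := by
  obtain ⟨χ, hχ, hχc, hχ0, hχ1⟩ : ∃ χ : ℝ → ℝ, ContDiff ℝ ∞ χ ∧ HasCompactSupport χ ∧ χ 0 = 1 ∧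
      ∀ x, ‖χ x‖ ≤ 1 := by
    let χ : ContDiffBump (0 : ℝ) := ⟨1, 2, one_pos, one_lt_two⟩
    refine ⟨χ, χ.contDiff, χ.hasCompactSupport,
      χ.one_of_mem_closedBall (by simp [χ.rIn_pos.le]), fun x => ?_⟩
    rw [Real.norm_of_nonneg χ.nonneg]
    exact χ.le_one
  have hdχ : Continuous (deriv χ) := hχ.continuous_deriv (by simp)
  obtain ⟨C, hC⟩ := hdχ.bounded_above_of_compact_support hχc.deriv
  have hψc : Continuous ψ := hψ.continuous
  have hψc' : Continuous (deriv ψ) := hψ.continuous_deriv (by simp)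
  let ε : ℕ → ℝ := fun N => 1 / ((N : ℝ) + 1)
  have hε0 : ∀ N, 0 < ε N := fun N => Nat.one_div_pos_of_nat
  have hε1 : ∀ N, ε N ≤ 1 := fun N => by
    simp only [ε]
    rw [div_le_one (by positivity)]
    have : (0 : ℝ) ≤ N := Nat.cast_nonneg N
    linarith
  have hεlim : Tendsto ε atTop (𝓝 0) := tendsto_one_div_add_atTop_nhds_zero_nat
  have hder : ∀ N x, deriv (fun x => χ (ε N * x) * ψ x) x =
      ε N * deriv χ (ε N * x) * ψ x + χ (ε N * x) * deriv ψ x := by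
    intro N x
    have h1 : HasDerivAt (fun x => χ (ε N * x)) (deriv χ (ε N * x) * (ε N * 1)) x :=
      HasDerivAt.comp (h₂ := χ) x ((hχ.differentiable (by simp)).differentiableAt.hasDerivAt)
        ((hasDerivAt_id x).const_mul (ε N))
    have h2 : HasDerivAt (fun x => χ (ε N * x) * ψ x) _ x :=
      h1.mul (hψ.differentiable (by simp)).differentiableAt.hasDerivAt
    rw [h2.deriv]
    ring
  have hident : ∀ N, ∫ x, (ε N * deriv χ (ε N * x) * ψ x + χ (ε N * x) * deriv ψ x) • f x =
      -∫ x, (χ (ε N * x) * ψ x) • g x := by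
    intro N
    have := h (fun x => χ (ε N * x) * ψ x) (by fun_prop)
      ((hχc.comp_homeomorph (Homeomorph.mulLeft₀ (ε N) (hε0 N).ne')).mul_right) (subset_univ _)
    simpa only [hder, Measure.restrict_univ] using this
  have hχlim : ∀ x, Tendsto (fun N => χ (ε N * x)) atTop (𝓝 1) := by
    intro x
    have h1 : Tendsto (fun N => ε N * x) atTop (𝓝 0) := by simpa using hεlim.mul_const x
    have h2 := (hχ.continuous.tendsto 0).comp h1
    rwa [hχ0] at h2
  have hl : Tendsto (fun N => ∫ x, (ε N * deriv χ (ε N * x) * ψ x + χ (ε N * x) * deriv ψ x) • f x)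
      atTop (𝓝 (∫ x, deriv ψ x • f x)) := by
    refine tendsto_integral_of_dominated_convergence
      (fun x => C * (‖ψ x‖ * ‖f x‖) + ‖deriv ψ x‖ * ‖f x‖) ?_ ?_ ?_ ?_
    · intro N
      exact (by fun_prop : Continuous fun x => ε N * deriv χ (ε N * x) * ψ x +
        χ (ε N * x) * deriv ψ x).aestronglyMeasurable.smul hf.1
    · exact ((hψ₂.norm.integrable_mul hf.norm).const_mul C).add (hψ'.norm.integrable_mul hf.norm)
    · intro N
      refine Eventually.of_forall fun x => ?_
      rw [norm_smul, ← mul_assoc, ← add_mul]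
      refine mul_le_mul_of_nonneg_right ((norm_add_le _ _).trans (add_le_add ?_ ?_)) (norm_nonneg _)
      · rw [norm_mul, norm_mul, Real.norm_of_nonneg (hε0 N).le]
        refine mul_le_mul_of_nonneg_right ?_ (norm_nonneg _)
        calc ε N * ‖deriv χ (ε N * x)‖ ≤ 1 * C := mul_le_mul (hε1 N) (hC _) (norm_nonneg _) zero_le_one
          _ = C := one_mul C
      · rw [norm_mul]
        exact mul_le_of_le_one_left (norm_nonneg _) (hχ1 _)
    · refine Eventually.of_forall fun x => ?_
      refine Tendsto.smul_const ?_ _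
      have h1 : Tendsto (fun N => ε N * deriv χ (ε N * x) * ψ x) atTop (𝓝 0) := by
        have h2 : Tendsto (fun N => ε N * x) atTop (𝓝 0) := by simpa using hεlim.mul_const x
        have h3 := ((hεlim.mul ((hdχ.tendsto 0).comp h2)).mul_const (ψ x))
        simpa using h3
      simpa using h1.add ((hχlim x).mul_const (deriv ψ x))
  have hr : Tendsto (fun N => -∫ x, (χ (ε N * x) * ψ x) • g x) atTop (𝓝 (-∫ x, ψ x • g x)) := by
    refine (tendsto_integral_of_dominated_convergence (fun x => ‖ψ x‖ * ‖g x‖) ?_ ?_ ?_ ?_).neg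
    · intro N
      exact (by fun_prop : Continuous fun x => χ (ε N * x) * ψ x).aestronglyMeasurable.smul hg.1
    · exact hψ₂.norm.integrable_mul hg.norm
    · intro N
      refine Eventually.of_forall fun x => ?_
      rw [norm_smul, norm_mul]
      exact mul_le_mul_of_nonneg_right (mul_le_of_le_one_left (norm_nonneg _) (hχ1 _))
        (norm_nonneg _)
    · refine Eventually.of_forall fun x => ?_
      refine Tendsto.smul_const ?_ _
      simpa using (hχlim x).mul_const (ψ x)
  simp only [hident] at hl
  exact tendsto_nhds_unique hl hr

/-- Weak derivatives of `L²` functions on the line can be tested against Schwartz functions. -/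
theorem hasWeakDeriv_univ_iff_schwartz {f g : ℝ → ℂ} (hf : MemLp f 2 volume)
    (hg : MemLp g 2 volume) :
    HasWeakDeriv univ f g ↔ ∀ φ : 𝓢(ℝ, ℂ), ∫ x, deriv φ x • f x = -∫ x, φ x • g x := by
  constructor
  · intro h φ
    have hd : ∀ x, HasDerivAt φ (deriv φ x) x := fun x => φ.differentiableAt.hasDerivAt
    have hφ : ContDiff ℝ ∞ φ := φ.smooth ⊤
    have hφ2 : MemLp φ 2 volume := φ.memLp 2
    have hφ2' : MemLp (deriv φ) 2 volume := (SchwartzMap.derivCLM ℂ ℂ φ).memLp 2 volume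
    have hre : ∀ x, deriv (fun x => (φ x).re) x = (deriv φ x).re := fun x =>
      ((Complex.reCLM.hasFDerivAt.comp_hasDerivAt x (hd x))).deriv
    have him : ∀ x, deriv (fun x => (φ x).im) x = (deriv φ x).im := fun x =>
      ((Complex.imCLM.hasFDerivAt.comp_hasDerivAt x (hd x))).deriv
    have h1 := h.integral_of_memLp hf hg (ψ := fun x => (φ x).re)
      (Complex.reCLM.contDiff.comp hφ) hφ2.re (by
        rw [show deriv (fun x => (φ x).re) = fun x => (deriv φ x).re from funext hre]
        exact hφ2'.re)
    have h2 := h.integral_of_memLp hf hg (ψ := fun x => (φ x).im)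
      (Complex.imCLM.contDiff.comp hφ) hφ2.im (by
        rw [show deriv (fun x => (φ x).im) = fun x => (deriv φ x).im from funext him]
        exact hφ2'.im)
    simp only [hre, him] at h1 h2
    -- Weak derivatives are tested against real functions, so a complex Schwartz function is handled
    -- through its real and imaginary parts.
    have split : ∀ (u w : ℝ → ℂ), MemLp u 2 volume → MemLp w 2 volume →
        ∫ x, u x • w x = (∫ x, (u x).re • w x) + Complex.I • ∫ x, (u x).im • w x := by
      intro u w hu hw
      rw [← integral_smul, ← integral_add]
      · refine integral_congr_ae (Eventually.of_forall fun x => ?_)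
        simp only [smul_eq_mul, Complex.real_smul]
        nth_rewrite 1 [← Complex.re_add_im (u x)]
        ring
      · simp only [Complex.real_smul]
        exact (hu.re.ofReal (K := ℂ)).integrable_mul hw
      · refine Integrable.fun_smul _ ?_
        simp only [Complex.real_smul]
        exact (hu.im.ofReal (K := ℂ)).integrable_mul hw
    rw [split _ _ hφ2' hf, split _ _ hφ2 hg, h1, h2, smul_neg, neg_add]
  · intro h φ k1 k2 _
    have hg₁ : HasCompactSupport (Complex.ofRealCLM ∘ φ) := k2.comp_left rfl
    have hg₂ : ContDiff ℝ ∞ (Complex.ofRealCLM ∘ φ) := by fun_prop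
    have := h (hg₁.toSchwartzMap hg₂)
    have hd : ∀ x, deriv (hg₁.toSchwartzMap hg₂) x = ((deriv φ x : ℝ) : ℂ) := fun x =>
      (((k1.differentiable (by simp)).differentiableAt (x := x)).hasDerivAt.ofReal_comp).deriv
    simp only [hd] at this
    simpa [Measure.restrict_univ] using this

/-- As a statement about tempered distributions, the weak derivative becomes accessible to the
Fourier transform. -/
theorem hasWeakDeriv_univ_iff_lineDeriv (f g : L2Line) :
    HasWeakDeriv univ f g ↔
      ∂_{(1 : ℝ)} (f : 𝓢'(ℝ, ℂ)) = (g : 𝓢'(ℝ, ℂ)) := by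
  rw [hasWeakDeriv_univ_iff_schwartz (Lp.memLp f) (Lp.memLp g)]
  have e : ∀ φ : 𝓢(ℝ, ℂ), (∂_{(1 : ℝ)} (f : 𝓢'(ℝ, ℂ))) φ = -∫ x, deriv φ x • f x := by
    intro φ
    rw [TemperedDistribution.lineDerivOp_apply_apply, map_neg, Lp.toTemperedDistribution_apply]
    simp only [SchwartzMap.lineDerivOp_apply_eq_fderiv, fderiv_apply_one_eq_deriv]
  constructor
  · intro h
    ext φ
    rw [e, h, neg_neg, Lp.toTemperedDistribution_apply]
  · intro h φ
    have := DFunLike.congr_fun h φ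
    rw [e, Lp.toTemperedDistribution_apply] at this
    rw [← this, neg_neg]

/-- The Fourier transform turns the weak derivative into multiplication by `2πiξ`. -/
theorem hasWeakDeriv_univ_iff_fourier (f g : L2Line) :
    HasWeakDeriv univ f g ↔
      (𝓕 g : L2Line) =ᵐ[volume] fun ξ => 2 * Real.pi * Complex.I * ξ * (𝓕 f : L2Line) ξ := by
  rw [hasWeakDeriv_univ_iff_lineDeriv]
  have hinj : (∂_{(1 : ℝ)} (f : 𝓢'(ℝ, ℂ)) = (g : 𝓢'(ℝ, ℂ))) ↔
      𝓕 (∂_{(1 : ℝ)} (f : 𝓢'(ℝ, ℂ))) = 𝓕 (g : 𝓢'(ℝ, ℂ)) := by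
    refine ⟨fun h => by rw [h], fun h => ?_⟩
    have := congrArg (fun u : 𝓢'(ℝ, ℂ) => 𝓕⁻ u) h
    simpa using this
  rw [hinj, TemperedDistribution.fourier_lineDerivOp_eq, Lp.fourier_toTemperedDistribution_eq,
    Lp.fourier_toTemperedDistribution_eq]
  have hgrowth : (fun x : ℝ => (((inner ℝ x (1 : ℝ) : ℝ)) : ℂ)).HasTemperateGrowth := by fun_prop
  have e : ∀ φ : 𝓢(ℝ, ℂ), ((2 * Real.pi * Complex.I) • TemperedDistribution.smulLeftCLM ℂ
      (fun x : ℝ => ((inner ℝ x (1 : ℝ) : ℝ) : ℂ)) ((𝓕 f : L2Line) : 𝓢'(ℝ, ℂ))) φ =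
      ∫ ξ, φ ξ • (2 * Real.pi * Complex.I * ξ * (𝓕 f : L2Line) ξ) := by
    intro φ
    rw [smul_apply, TemperedDistribution.smulLeftCLM_apply_apply, Lp.toTemperedDistribution_apply,
      ← integral_smul]
    refine integral_congr_ae (Eventually.of_forall fun x => ?_)
    simp only [SchwartzMap.smulLeftCLM_apply_apply hgrowth, smul_eq_mul]
    simp
    ring
  constructor
  · intro h
    have hloc₁ : LocallyIntegrable (𝓕 g : L2Line) volume :=
      (Lp.memLp (𝓕 g : L2Line)).locallyIntegrable (by norm_num)
    have hloc₂ : LocallyIntegrable (fun ξ => 2 * Real.pi * Complex.I * ξ * (𝓕 f : L2Line) ξ)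
        volume :=
      ((Lp.memLp (𝓕 f : L2Line)).locallyIntegrable (by norm_num)).continuous_mul (by fun_prop)
    have key := ae_eq_zero_of_integral_contDiff_smul_eq_zero (hloc₁.sub hloc₂) fun φ k1 k2 => by
      have hg₁ : HasCompactSupport (Complex.ofRealCLM ∘ φ) := k2.comp_left rfl
      have hg₂ : ContDiff ℝ ∞ (Complex.ofRealCLM ∘ φ) := by fun_prop
      have := DFunLike.congr_fun h (hg₁.toSchwartzMap hg₂)
      rw [e, Lp.toTemperedDistribution_apply] at this
      simp only [Pi.sub_apply, smul_sub]
      rw [integral_sub (hloc₁.integrable_smul_left_of_hasCompactSupport k1.continuous k2)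
        (hloc₂.integrable_smul_left_of_hasCompactSupport k1.continuous k2), sub_eq_zero]
      simpa using this.symm
    filter_upwards [key] with x hx
    exact sub_eq_zero.1 hx
  · intro h
    ext φ
    rw [e, Lp.toTemperedDistribution_apply]
    refine integral_congr_ae ?_
    filter_upwards [h] with x hx
    rw [hx]

end LineFourier

/-! ### The free Schrödinger group as a Fourier multiplier -/

section FreeGroup

/-- The symbol `-(2πξ)²` of the Laplacian. -/
def laplacianSymbol (ξ : ℝ) : ℝ := -(2 * Real.pi * ξ) ^ 2

theorem measurable_laplacianSymbol : Measurable laplacianSymbol := by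
  unfold laplacianSymbol
  fun_prop

theorem fourier_fourierInv_coeFn (u : L2Line) : (𝓕 (𝓕⁻ u : L2Line) : L2Line) = u :=
  FourierTransform.fourier_fourierInv_eq u

/-- Applying the derivative twice squares `2πiξ`. The converse must produce the intermediate first
derivative: `ξ f̂` is in `L²` as soon as `f̂` and `ξ² f̂` are. -/
theorem mem_laplacianLineGraph_iff (f h : L2Line) :
    (f, h) ∈ laplacianLineGraph ↔
      (𝓕 h : L2Line) =ᵐ[volume] fun ξ => laplacianSymbol ξ * (𝓕 f : L2Line) ξ := by
  have hsq : ∀ ξ : ℝ, (2 * Real.pi * Complex.I * ξ) * (2 * Real.pi * Complex.I * ξ) =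
      (laplacianSymbol ξ : ℂ) := fun ξ => by
    rw [laplacianSymbol]
    push_cast
    linear_combination (2 * Real.pi * ξ : ℂ) ^ 2 * Complex.I_mul_I
  constructor
  · rintro ⟨f', h1, h2⟩
    rw [hasWeakDeriv_univ_iff_fourier] at h1 h2
    filter_upwards [h1, h2] with ξ k1 k2
    rw [k2, k1, ← mul_assoc, hsq]
  · intro h0
    have hmem : MemLp (fun ξ => 2 * Real.pi * Complex.I * ξ * (𝓕 f : L2Line) ξ) 2 volume := by
      refine ((Lp.memLp (𝓕 f : L2Line)).norm.add (Lp.memLp (𝓕 h : L2Line)).norm).of_le ?_ ?_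
      · exact (by fun_prop : Continuous fun ξ : ℝ =>
          2 * Real.pi * Complex.I * (ξ : ℂ)).aestronglyMeasurable.mul (Lp.aestronglyMeasurable _)
      · filter_upwards [h0] with ξ hξ
        rw [Pi.add_apply, hξ, ← hsq, Real.norm_of_nonneg (by positivity)]
        generalize 2 * Real.pi * Complex.I * (ξ : ℂ) = z
        have := norm_nonneg ((𝓕 f : L2Line) ξ)
        simp only [norm_mul]
        -- This is `|z| ≤ 1 + |z|²` multiplied by the norm of `f̂(ξ)`.
        nlinarith [mul_nonneg this (sq_nonneg (‖z‖ - 1)), mul_nonneg this (sq_nonneg ‖z‖)]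
    refine ⟨𝓕⁻ (hmem.toLp _), ?_, ?_⟩
    · rw [hasWeakDeriv_univ_iff_fourier, fourier_fourierInv_coeFn]
      exact hmem.coeFn_toLp
    · rw [hasWeakDeriv_univ_iff_fourier, fourier_fourierInv_coeFn]
      filter_upwards [h0, hmem.coeFn_toLp] with ξ k1 k2
      rw [k1, k2, ← mul_assoc, hsq]

/-- The group generated by `iΔ`, as a Fourier multiplier. -/
def freeMultiplier (t : ℝ) : L2Line →L[ℂ] L2Line :=
  ((Lp.fourierTransformₗᵢ ℝ ℂ).symm.toLinearIsometry.comp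
    ((phaseMul volume measurable_laplacianSymbol t).comp
      (Lp.fourierTransformₗᵢ ℝ ℂ).toLinearIsometry)).toContinuousLinearMap

theorem freeMultiplier_apply (t : ℝ) (f : L2Line) :
    freeMultiplier t f = 𝓕⁻ (phaseMul volume measurable_laplacianSymbol t (𝓕 f : L2Line)) := rfl

theorem fourier_freeMultiplier (t : ℝ) (f : L2Line) :
    (𝓕 (freeMultiplier t f) : L2Line) =
      phaseMul volume measurable_laplacianSymbol t (𝓕 f : L2Line) := by
  rw [freeMultiplier_apply, fourier_fourierInv_coeFn]

theorem mem_smul_graph_iff {E : Type*} [AddCommGroup E] [Module ℂ E] (T : E →ₗ.[ℂ] E) {c : ℂ}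
    (hc : c ≠ 0) (f g : E) : (f, g) ∈ (c • T).graph ↔ (f, c⁻¹ • g) ∈ T.graph := by
  rw [LinearPMap.smul_graph, Submodule.mem_map]
  constructor
  · rintro ⟨⟨a, b⟩, hab, h⟩
    obtain ⟨rfl, rfl⟩ := Prod.mk.inj h
    simpa [smul_smul, hc] using hab
  · intro h
    exact ⟨_, h, by simp [smul_smul, hc]⟩

/-- Plancherel transports every axiom, and the generator with its exact domain, from the phase
multiplication. -/
theorem isGroupGeneratedBy_freeMultiplier :
    IsGroupGeneratedBy freeMultiplier (Complex.I • laplacianLine) where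
  map_zero := by
    ext1 f
    rw [freeMultiplier_apply, phaseMul_zero]
    exact FourierTransform.fourierInv_fourier_eq f
  map_add s t := by
    ext1 f
    change freeMultiplier (s + t) f = freeMultiplier s (freeMultiplier t f)
    rw [freeMultiplier_apply, freeMultiplier_apply s, fourier_freeMultiplier, phaseMul_add]
  norm_map t f := ((Lp.fourierTransformₗᵢ ℝ ℂ).symm.toLinearIsometry.comp
    ((phaseMul volume measurable_laplacianSymbol t).comp
      (Lp.fourierTransformₗᵢ ℝ ℂ).toLinearIsometry)).norm_map f
  continuous f := (Lp.fourierTransformₗᵢ ℝ ℂ).symm.continuous.comp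
    (continuous_phaseMul measurable_laplacianSymbol _)
  generator f g := by
    rw [mem_smul_graph_iff _ Complex.I_ne_zero, laplacianLine_graph, mem_laplacianLineGraph_iff]
    have hF : HasSlopeLimit (fun t => freeMultiplier t f) g ↔
        HasSlopeLimit (fun t => phaseMul volume measurable_laplacianSymbol t (𝓕 f : L2Line))
          (𝓕 g : L2Line) := by
      constructor
      · intro h
        have := h.map ((Lp.fourierTransformₗᵢ ℝ ℂ).toContinuousLinearEquiv : L2Line →L[ℂ] L2Line)
        refine Tendsto.congr (fun t => ?_) this
        simp only [← fourier_freeMultiplier]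
        rfl
      · intro h
        have := h.map
          ((Lp.fourierTransformₗᵢ ℝ ℂ).symm.toContinuousLinearEquiv : L2Line →L[ℂ] L2Line)
        have e : 𝓕⁻ (𝓕 g : L2Line) = g := FourierTransform.fourierInv_fourier_eq g
        rw [← e]
        exact this
    rw [← hasSlopeLimit_iff_hasDerivAt, hF, hasSlopeLimit_phaseMul_iff]
    have e : (𝓕 (Complex.I⁻¹ • g) : L2Line) = Complex.I⁻¹ • (𝓕 g : L2Line) :=
      FourierTransform.fourier_smul _ _
    rw [e]
    have hs := Lp.coeFn_smul (Complex.I⁻¹) (𝓕 g : L2Line)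
    constructor
    · intro h
      filter_upwards [h, hs] with ξ h1 h2
      rw [h2, Pi.smul_apply, smul_eq_mul, inv_mul_eq_iff_eq_mul₀ Complex.I_ne_zero] at h1
      rw [h1, mul_assoc]
    · intro h
      filter_upwards [h, hs] with ξ h1 h2
      rw [h2, Pi.smul_apply, h1, smul_eq_mul, mul_assoc, inv_mul_cancel_left₀ Complex.I_ne_zero]

theorem isGroupGeneratedBy_freeGroup :
    IsGroupGeneratedBy freeGroup (Complex.I • laplacianLine) :=
  isGroupGeneratedBy_expGroup isGroupGeneratedBy_freeMultiplier

theorem freeGroup_eq : freeGroup = freeMultiplier :=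
  expGroup_eq isGroupGeneratedBy_freeMultiplier

/-- The free group commutes with the derivative. -/
theorem HasWeakDeriv.freeGroup {f g : L2Line} (h : HasWeakDeriv univ f g) (t : ℝ) :
    HasWeakDeriv univ (freeGroup t f) (freeGroup t g) := by
  rw [hasWeakDeriv_univ_iff_fourier] at h ⊢
  rw [freeGroup_eq, fourier_freeMultiplier, fourier_freeMultiplier]
  filter_upwards [h, coeFn_phaseMul measurable_laplacianSymbol t (𝓕 f : L2Line),
    coeFn_phaseMul measurable_laplacianSymbol t (𝓕 g : L2Line)] with ξ h1 h2 h3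
  rw [h3, h2, h1]
  ring

/-- The free Laplacian has no eigenfunctions. -/
theorem eq_zero_of_mem_laplacianLineGraph {f : L2Line} {c : ℂ}
    (h : (f, c • f) ∈ laplacianLineGraph) : f = 0 := by
  rw [mem_laplacianLineGraph_iff] at h
  have e : (𝓕 (c • f) : L2Line) = c • (𝓕 f : L2Line) := FourierTransform.fourier_smul _ _
  rw [e] at h
  -- A level set of the symbol has at most two points, hence is null; off it the eigenvalue equation
  -- forces `f̂ = 0`.
  have hfin : {ξ : ℝ | (laplacianSymbol ξ : ℂ) = c}.Finite := by
    by_cases hc : ∃ ξ₀ : ℝ, (laplacianSymbol ξ₀ : ℂ) = c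
    · obtain ⟨ξ₀, rfl⟩ := hc
      refine (toFinite {ξ₀, -ξ₀}).subset fun ξ hξ => ?_
      have h1 : laplacianSymbol ξ = laplacianSymbol ξ₀ := Complex.ofReal_injective hξ
      simp only [laplacianSymbol, neg_inj, mul_pow] at h1
      exact sq_eq_sq_iff_eq_or_eq_neg.1 (mul_left_cancel₀ (by positivity) h1)
    · convert finite_empty (α := ℝ)
      exact eq_empty_of_forall_notMem fun ξ hξ => hc ⟨ξ, hξ⟩
  have hne : ∀ᵐ ξ : ℝ, (laplacianSymbol ξ : ℂ) ≠ c := by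
    rw [ae_iff]
    simpa using hfin.measure_zero volume
  have hz : (𝓕 f : L2Line) = 0 := by
    refine Lp.ext ?_
    filter_upwards [h, Lp.coeFn_smul c (𝓕 f : L2Line), hne, Lp.coeFn_zero ℂ 2 volume]
      with ξ h1 h2 h3 h4
    rw [h4, Pi.zero_apply]
    rw [h2, Pi.smul_apply, smul_eq_mul] at h1
    have h5 : ((laplacianSymbol ξ : ℂ) - c) * (𝓕 f : L2Line) ξ = 0 := by
      rw [sub_mul, h1, sub_self]
    exact (mul_eq_zero.1 h5).resolve_left (sub_ne_zero.2 h3)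
  exact (Lp.fourierTransformₗᵢ ℝ ℂ).map_eq_zero_iff.1 hz

/-- Functions in `W^{1,2}(ℝ)` have a continuous representative. -/
theorem HasWeakDeriv.exists_continuous {f g : L2Line} (h : HasWeakDeriv univ f g) :
    ∃ F : ℝ → ℂ, Continuous F ∧ f =ᵐ[volume] F := by
  rw [hasWeakDeriv_univ_iff_fourier] at h
  -- Cauchy–Schwarz: `|f̂|` is at most `(1 + ξ²)^(-1/2)`, which is in `L²`, times `|f̂| + |ĝ|`,
  -- because `√(1 + ξ²) ≤ 1 + 2π|ξ|`.
  have hint : Integrable (𝓕 f : L2Line) volume := by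
    have hw : MemLp (fun ξ : ℝ => Real.sqrt ((1 + ξ ^ 2)⁻¹)) 2 volume := by
      rw [memLp_two_iff_integrable_sq (by fun_prop)]
      refine integrable_inv_one_add_sq.congr (Eventually.of_forall fun ξ => ?_)
      simp only
      rw [Real.sq_sqrt (by positivity)]
    refine (hw.integrable_mul ((Lp.memLp (𝓕 f : L2Line)).norm.add
      (Lp.memLp (𝓕 g : L2Line)).norm)).mono' (Lp.aestronglyMeasurable _) ?_
    filter_upwards [h] with ξ hξ
    rw [Pi.mul_apply, Pi.add_apply, hξ, norm_mul]
    have h0 := norm_nonneg ((𝓕 f : L2Line) ξ)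
    have h1 : ‖2 * Real.pi * Complex.I * (ξ : ℂ)‖ = 2 * Real.pi * |ξ| := by
      simp [abs_of_pos Real.pi_pos]
    rw [h1, ← one_add_mul, ← mul_assoc, Real.sqrt_inv]
    refine le_mul_of_one_le_left h0 ?_
    rw [inv_mul_eq_div, one_le_div (by positivity), Real.sqrt_le_left (by positivity)]
    have hπ := Real.pi_gt_three
    nlinarith [abs_nonneg ξ, sq_abs ξ, mul_nonneg (abs_nonneg ξ) Real.pi_pos.le,
      mul_le_mul_of_nonneg_right (by nlinarith : (1 : ℝ) ≤ (2 * Real.pi) ^ 2) (sq_nonneg ξ)]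
  have hcont : Continuous (𝓕⁻ ((𝓕 f : L2Line) : ℝ → ℂ)) :=
    VectorFourier.fourierIntegral_continuous Real.continuous_fourierChar (by fun_prop) hint
  refine ⟨𝓕⁻ ((𝓕 f : L2Line) : ℝ → ℂ), hcont, ?_⟩
  have hl1 : LocallyIntegrable f volume := (Lp.memLp f).locallyIntegrable (by norm_num)
  have hl2 : LocallyIntegrable (𝓕⁻ ((𝓕 f : L2Line) : ℝ → ℂ)) volume := hcont.locallyIntegrable
  -- The `L²` function and the inverse Fourier integral agree against every test function: the
  -- inverse transform is moved to the test function, by the definition of the distributional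
  -- transform for one and by Fubini for the other.
  have key := ae_eq_zero_of_integral_contDiff_smul_eq_zero (hl1.sub hl2) fun φ k1 k2 => by
    have hg₁ : HasCompactSupport (Complex.ofRealCLM ∘ φ) := k2.comp_left rfl
    have hg₂ : ContDiff ℝ ∞ (Complex.ofRealCLM ∘ φ) := by fun_prop
    set ψ := hg₁.toSchwartzMap hg₂ with hψ
    simp only [Pi.sub_apply, smul_sub]
    rw [integral_sub (hl1.integrable_smul_left_of_hasCompactSupport k1.continuous k2)
      (hl2.integrable_smul_left_of_hasCompactSupport k1.continuous k2), sub_eq_zero]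
    have e1 : ∫ x, φ x • f x = ∫ x, (𝓕⁻ ψ : 𝓢(ℝ, ℂ)) x • (𝓕 f : L2Line) x := by
      rw [← Lp.toTemperedDistribution_apply, ← Lp.fourier_toTemperedDistribution_eq,
        TemperedDistribution.fourier_apply, FourierTransform.fourier_fourierInv_eq,
        Lp.toTemperedDistribution_apply]
      simp [hψ]
    have e2 := VectorFourier.integral_fourierIntegral_smul_eq_flip (L := -innerₗ ℝ)
      Real.continuous_fourierChar (by fun_prop) (ψ.integrable (μ := volume)) hint
    rw [e1]
    have e3 : ∀ x, (𝓕⁻ ψ : 𝓢(ℝ, ℂ)) x = 𝓕⁻ (ψ : ℝ → ℂ) x := fun x => by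
      rw [SchwartzMap.fourierInv_coe]
    simp only [e3]
    have hflip : (-innerₗ ℝ : ℝ →ₗ[ℝ] ℝ →ₗ[ℝ] ℝ).flip = -innerₗ ℝ := by
      ext
      simp
    rw [hflip] at e2
    refine Eq.trans e2 (integral_congr_ae (Eventually.of_forall fun x => ?_))
    simp only [hψ, HasCompactSupport.toSchwartzMap_toFun, Function.comp_apply,
      Complex.ofRealCLM_apply]
    rfl
  filter_upwards [key] with x hx
  exact sub_eq_zero.1 hx

end FreeGroup

/-! ### Extension by zero, restriction and reflection -/

section LineMaps

theorem coeFn_extendZero (f : L2Edge) :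
    extendZero f =ᵐ[volume] (Ioi (0 : ℝ)).indicator f :=
  MemLp.coeFn_toLp _

theorem coeFn_restrictEdge (f : L2Line) :
    restrictEdge f =ᵐ[volume.restrict (Ioi (0 : ℝ))] f :=
  MemLp.coeFn_toLp _

theorem coeFn_extendZero_restrict (f : L2Edge) :
    extendZero f =ᵐ[volume.restrict (Ioi (0 : ℝ))] f := by
  filter_upwards [ae_restrict_of_ae (coeFn_extendZero f), ae_restrict_mem measurableSet_Ioi]
    with x h1 h2
  rw [h1, indicator_of_mem h2]

/-- The extension by zero as a linear isometry. -/
def extendZeroₗᵢ : L2Edge →ₗᵢ[ℂ] L2Line where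
  toFun := extendZero
  map_add' f g := by
    refine Lp.ext ?_
    have h := ae_imp_of_ae_restrict (Lp.coeFn_add f g)
    filter_upwards [coeFn_extendZero (f + g), coeFn_extendZero f, coeFn_extendZero g,
      Lp.coeFn_add (extendZero f) (extendZero g), h] with x h1 h2 h3 h4 h5
    rw [h1, h4, Pi.add_apply, h2, h3]
    by_cases hx : x ∈ Ioi (0 : ℝ)
    · simp only [indicator_of_mem hx, h5 hx, Pi.add_apply]
    · simp only [indicator_of_notMem hx, add_zero]
  map_smul' c f := by
    refine Lp.ext ?_
    have h := ae_imp_of_ae_restrict (Lp.coeFn_smul c f)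
    filter_upwards [coeFn_extendZero (c • f), coeFn_extendZero f,
      Lp.coeFn_smul c (extendZero f), h] with x h1 h2 h4 h5
    rw [h1, RingHom.id_apply, h4, Pi.smul_apply, h2]
    by_cases hx : x ∈ Ioi (0 : ℝ)
    · simp only [indicator_of_mem hx, h5 hx, Pi.smul_apply]
    · simp only [indicator_of_notMem hx, smul_zero]
  norm_map' f := by
    change ‖extendZero f‖ = ‖f‖
    rw [extendZero, Lp.norm_toLp, Lp.norm_def,
      eLpNorm_indicator_eq_eLpNorm_restrict measurableSet_Ioi]

/-- The restriction to the half-line as a continuous linear map. -/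
def restrictEdgeL : L2Line →L[ℂ] L2Edge :=
  LinearMap.mkContinuous
    { toFun := restrictEdge
      map_add' := fun f g => by
        refine Lp.ext ?_
        filter_upwards [coeFn_restrictEdge (f + g), coeFn_restrictEdge f, coeFn_restrictEdge g,
          Lp.coeFn_add (restrictEdge f) (restrictEdge g),
          ae_restrict_of_ae (Lp.coeFn_add f g)] with x h1 h2 h3 h4 h5
        rw [h1, h4, h5, Pi.add_apply, Pi.add_apply, h2, h3]
      map_smul' := fun c f => by
        refine Lp.ext ?_
        filter_upwards [coeFn_restrictEdge (c • f), coeFn_restrictEdge f,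
          Lp.coeFn_smul c (restrictEdge f),
          ae_restrict_of_ae (Lp.coeFn_smul c f)] with x h1 h2 h4 h5
        rw [h1, RingHom.id_apply, h4, h5, Pi.smul_apply, Pi.smul_apply, h2] } 1 fun f => by
    change ‖restrictEdge f‖ ≤ 1 * ‖f‖
    rw [one_mul, restrictEdge, Lp.norm_toLp, Lp.norm_def]
    exact ENNReal.toReal_mono (Lp.eLpNorm_ne_top f) (eLpNorm_restrict_le _ _ _ _)

theorem restrictEdgeL_apply (f : L2Line) : restrictEdgeL f = restrictEdge f := rfl

theorem extendZeroₗᵢ_apply (f : L2Edge) : extendZeroₗᵢ f = extendZero f := rfl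

/-- The reflection `f ↦ f (-·)` on `L²(ℝ)`. -/
def reflect : L2Line →ₗᵢ[ℂ] L2Line :=
  Lp.compMeasurePreservingₗᵢ ℂ Neg.neg (Measure.measurePreserving_neg volume)

theorem coeFn_reflect (f : L2Line) : reflect f =ᵐ[volume] fun x => f (-x) :=
  Lp.coeFn_compMeasurePreserving f (Measure.measurePreserving_neg volume)

theorem ae_comp_neg {p : ℝ → Prop} (h : ∀ᵐ x, p x) : ∀ᵐ x, p (-x) :=
  (Measure.measurePreserving_neg (volume : Measure ℝ)).quasiMeasurePreserving.ae h

theorem reflect_reflect (f : L2Line) : reflect (reflect f) = f := by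
  refine Lp.ext ?_
  filter_upwards [coeFn_reflect (reflect f), ae_comp_neg (coeFn_reflect f)] with x h1 h2
  rw [h1, h2, neg_neg]

theorem restrictEdge_extendZero (f : L2Edge) : restrictEdge (extendZero f) = f := by
  refine Lp.ext ?_
  filter_upwards [coeFn_restrictEdge (extendZero f), coeFn_extendZero_restrict f] with x h1 h2
  rw [h1, h2]

theorem coeFn_reflect_extendZero (f : L2Edge) :
    reflect (extendZero f) =ᵐ[volume] fun x => (Ioi (0 : ℝ)).indicator f (-x) := by
  filter_upwards [coeFn_reflect (extendZero f), ae_comp_neg (coeFn_extendZero f)] with x h1 h2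
  rw [h1, h2]

theorem restrictEdge_reflect_extendZero (f : L2Edge) :
    restrictEdge (reflect (extendZero f)) = 0 := by
  refine Lp.ext ?_
  filter_upwards [coeFn_restrictEdge (reflect (extendZero f)),
    ae_restrict_of_ae (coeFn_reflect_extendZero f), ae_restrict_mem measurableSet_Ioi,
    Lp.coeFn_zero ℂ 2 (volume.restrict (Ioi (0 : ℝ)))] with x h1 h2 h3 h4
  rw [h1, h2, h4, indicator_of_notMem, Pi.zero_apply]
  simp only [mem_Ioi] at h3 ⊢
  linarith

theorem extendZero_add_reflect (g : L2Line) :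
    extendZero (restrictEdge g) + reflect (extendZero (restrictEdge (reflect g))) = g := by
  refine Lp.ext ?_
  have h1 := ae_imp_of_ae_restrict (coeFn_restrictEdge g)
  have h2 := ae_comp_neg (ae_imp_of_ae_restrict (coeFn_restrictEdge (reflect g)))
  -- The origin lies in neither open half-line, so it has to be discarded as a null set.
  have h0 : ∀ᵐ x : ℝ, x ≠ 0 := by simp [ae_iff]
  filter_upwards [Lp.coeFn_add (extendZero (restrictEdge g))
      (reflect (extendZero (restrictEdge (reflect g)))), coeFn_extendZero (restrictEdge g),
    coeFn_reflect_extendZero (restrictEdge (reflect g)), h1, h2, ae_comp_neg (coeFn_reflect g), h0]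
    with x k1 k2 k3 k4 k5 k6 k7
  rw [k1, Pi.add_apply, k2, k3]
  rcases lt_or_gt_of_ne k7 with hx | hx
  · have hx1 : x ∉ Ioi (0 : ℝ) := by simpa using hx.le
    have hx2 : -x ∈ Ioi (0 : ℝ) := by simpa using hx
    rw [indicator_of_notMem hx1, indicator_of_mem hx2, k5 hx2, k6, neg_neg, zero_add]
  · have hx1 : x ∈ Ioi (0 : ℝ) := hx
    have hx2 : -x ∉ Ioi (0 : ℝ) := by simpa using hx.le
    rw [indicator_of_mem hx1, indicator_of_notMem hx2, k4 hx1, add_zero]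

/-- The two summands live on opposite half-lines and are therefore orthogonal. -/
theorem norm_sq_extendZero_add_reflect (f h : L2Edge) :
    ‖extendZero f + reflect (extendZero h)‖ ^ 2 = ‖f‖ ^ 2 + ‖h‖ ^ 2 := by
  have hz : inner ℂ (extendZero f) (reflect (extendZero h)) = 0 := by
    rw [L2.inner_def]
    refine integral_eq_zero_of_ae ?_
    filter_upwards [coeFn_extendZero f, coeFn_reflect_extendZero h] with x h1 h2
    rw [h1, h2]
    by_cases hx : x ∈ Ioi (0 : ℝ)
    · have hx2 : -x ∉ Ioi (0 : ℝ) := by simpa using (mem_Ioi.1 hx).le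
      rw [indicator_of_notMem hx2, inner_zero_right, Pi.zero_apply]
    · rw [indicator_of_notMem hx, inner_zero_left, Pi.zero_apply]
  rw [pow_two, norm_add_sq_eq_norm_sq_add_norm_sq_of_inner_eq_zero _ _ hz,
    LinearIsometry.norm_map, ← extendZeroₗᵢ_apply, ← extendZeroₗᵢ_apply, LinearIsometry.norm_map,
    LinearIsometry.norm_map, pow_two, pow_two]

/-- The pairs `(f, f')` with `f ∈ W^{1,2}(ℝ)`. -/
def derivLineGraph : Submodule ℂ (L2Line × L2Line) where
  carrier := {p | HasWeakDeriv univ p.1 p.2}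
  add_mem' := by
    rintro ⟨f, g⟩ ⟨f₁, g₁⟩ h1 k1
    have m : ∀ u : L2Line, MemLp u 2 (volume.restrict univ) := fun u => (Lp.memLp u).restrict _
    exact (h1.add (m _) (m _) (m _) (m _) k1).congr (ae_restrict_of_ae (Lp.coeFn_add _ _))
      (ae_restrict_of_ae (Lp.coeFn_add _ _))
  zero_mem' := (HasWeakDeriv.zero _).congr (ae_restrict_of_ae (Lp.coeFn_zero _ _ _))
      (ae_restrict_of_ae (Lp.coeFn_zero _ _ _))
  smul_mem' := by
    rintro c ⟨f, g⟩ h1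
    exact (h1.const_smul c).congr (ae_restrict_of_ae (Lp.coeFn_smul _ _))
      (ae_restrict_of_ae (Lp.coeFn_smul _ _))

theorem mem_derivLineGraph {f g : L2Line} : (f, g) ∈ derivLineGraph ↔ HasWeakDeriv univ f g :=
  Iff.rfl

theorem HasWeakDeriv.unique_line {f g g₁ : L2Line} (h : HasWeakDeriv univ f g)
    (h₁ : HasWeakDeriv univ f g₁) : g = g₁ := by
  have h2 : (f - f, g - g₁) ∈ derivLineGraph := derivLineGraph.sub_mem (x := (f, g)) (y := (f, g₁)) h h₁
  rw [sub_self, mem_derivLineGraph] at h2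
  have := h2.eq_zero isOpen_univ ((Lp.memLp _).restrict _)
    (ae_restrict_of_ae (Lp.coeFn_zero _ _ _))
  rw [Measure.restrict_univ] at this
  exact sub_eq_zero.1 (Lp.ext (this.trans (Lp.coeFn_zero _ _ _).symm))

theorem integral_deriv_smul_reflect (φ : ℝ → ℝ) (f : L2Line) :
    ∫ x, deriv φ x • reflect f x = -∫ x, deriv (fun x => φ (-x)) x • f x := by
  rw [← integral_neg, ← integral_neg_eq_self (fun x => -(deriv (fun x => φ (-x)) x • f x))]
  refine integral_congr_ae ?_
  filter_upwards [coeFn_reflect f] with x hx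
  rw [hx, deriv_comp_neg, neg_neg, neg_smul, neg_neg]

theorem integral_smul_reflect (φ : ℝ → ℝ) (f : L2Line) :
    ∫ x, φ x • reflect f x = ∫ x, φ (-x) • f x := by
  rw [← integral_neg_eq_self (fun x => φ (-x) • f x)]
  refine integral_congr_ae ?_
  filter_upwards [coeFn_reflect f] with x hx
  rw [hx, neg_neg]

theorem HasWeakDeriv.reflect {f g : L2Line} (h : HasWeakDeriv univ f g) :
    HasWeakDeriv univ (reflect f) (-reflect g : L2Line) := by
  intro φ k1 k2 k3
  have := h (fun x => φ (-x)) (k1.comp contDiff_neg)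
    (k2.comp_homeomorph (Homeomorph.neg ℝ)) (subset_univ _)
  rw [Measure.restrict_univ] at this ⊢
  rw [integral_deriv_smul_reflect, this, neg_neg]
  have e : ∫ x, φ x • (-StarGraph.reflect g : L2Line) x = -∫ x, φ x • StarGraph.reflect g x := by
    rw [← integral_neg]
    refine integral_congr_ae ?_
    filter_upwards [Lp.coeFn_neg (StarGraph.reflect g)] with x hx
    rw [hx, Pi.neg_apply, smul_neg]
  rw [e, neg_neg, integral_smul_reflect]

theorem HasWeakDeriv.restrictEdge {f g : L2Line} (h : HasWeakDeriv univ f g) :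
    HasWeakDeriv (Ioi 0) (restrictEdge f) (restrictEdge g) := by
  have h1 : HasWeakDeriv (Ioi 0) f g := by
    intro φ k1 k2 k3
    have := h φ k1 k2 (subset_univ _)
    rw [Measure.restrict_univ] at this
    rw [setIntegral_eq_integral_of_forall_compl_eq_zero,
      setIntegral_eq_integral_of_forall_compl_eq_zero, this]
    · intro x hx
      rw [image_eq_zero_of_notMem_tsupport fun hx' => hx (k3 hx'), zero_smul]
    · intro x hx
      rw [image_eq_zero_of_notMem_tsupport fun hx' => hx (k3 (tsupport_deriv_subset hx')), zero_smul]
  exact h1.congr (coeFn_restrictEdge f) (coeFn_restrictEdge g)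

theorem mem_laplacianLineGraph_reflect {f g : L2Line} (h : (f, g) ∈ laplacianLineGraph) :
    (reflect f, reflect g) ∈ laplacianLineGraph := by
  obtain ⟨f', h1, h2⟩ := h
  refine ⟨-reflect f', h1.reflect, ?_⟩
  have := derivLineGraph.neg_mem (x := (reflect f', -reflect g)) h2.reflect
  simpa [mem_derivLineGraph] using this

/-- The free group commutes with reflections. -/
theorem freeGroup_reflect (t : ℝ) (f : L2Line) :
    freeGroup t (reflect f) = reflect (freeGroup t f) := by
  have hU := isGroupGeneratedBy_freeGroup
  let R : L2Line →L[ℂ] L2Line := reflect.toContinuousLinearMap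
  have hR : ∀ f, R f = reflect f := fun _ => rfl
  have hRR : ∀ f, R (R f) = f := reflect_reflect
  -- Since `Δ_ℝ` commutes with the reflection, the conjugated group has the same generator, and
  -- uniqueness identifies it with the free group.
  have hV : IsGroupGeneratedBy (fun t => R ∘L freeGroup t ∘L R)
      (Complex.I • laplacianLine) :=
    { map_zero := by
        ext1 f
        simp [hU.map_zero, hRR]
      map_add := fun s t => by
        ext1 f
        simp [hU.add_apply, hRR]
      norm_map := fun t f => by
        simp only [ContinuousLinearMap.comp_apply, hR, LinearIsometry.norm_map, hU.norm_map]
      continuous := fun f => R.continuous.comp (hU.continuous (R f))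
      generator := fun f g => by
        have h1 : (f, g) ∈ (Complex.I • laplacianLine).graph ↔
            (R f, R g) ∈ (Complex.I • laplacianLine).graph := by
          rw [mem_smul_graph_iff _ Complex.I_ne_zero, mem_smul_graph_iff _ Complex.I_ne_zero,
            laplacianLine_graph]
          constructor
          · intro h
            have := mem_laplacianLineGraph_reflect h
            rwa [map_smul] at this
          · intro h
            have := mem_laplacianLineGraph_reflect h
            rwa [map_smul, hR, hR, reflect_reflect, reflect_reflect] at this
        rw [h1, hU.generator, ← hasSlopeLimit_iff_hasDerivAt, ← hasSlopeLimit_iff_hasDerivAt]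
        constructor
        · intro h
          have := h.map R
          rwa [hRR] at this
        · intro h
          have := h.map R
          simpa only [ContinuousLinearMap.comp_apply, hRR] using this }
  have := DFunLike.congr_fun (congrFun (hU.unique hV) t) (reflect f)
  rw [this]
  change R (freeGroup t (R (R f))) = _
  rw [hRR]
  rfl

end LineMaps

/-! ### Boundary terms on the half-line and gluing at the vertex -/

section Gluing

/-- A rescaled derivative of the smooth step, integrated against a function that is continuous up
to `0`, converges to the boundary value. -/
theorem tendsto_integral_deriv_smoothTransition {G : ℝ → ℂ} (hG : ContinuousOn G (Ici 0)) :
    Tendsto (fun N : ℕ => ∫ x in Ioi (0 : ℝ),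
      (((N : ℝ) + 1) * deriv Real.smoothTransition (((N : ℝ) + 1) * x - 1)) • G x)
      atTop (𝓝 (G 0)) := by
  have hσ : ContDiff ℝ ∞ Real.smoothTransition := Real.smoothTransition.contDiff
  have hσc : Continuous (deriv Real.smoothTransition) := hσ.continuous_deriv (by simp)
  have hσ1 : ∀ y, 1 < y → deriv Real.smoothTransition y = 0 := fun y hy => by
    have : Real.smoothTransition =ᶠ[𝓝 y] fun _ => (1 : ℝ) := by
      filter_upwards [lt_mem_nhds hy] with z hz
      exact Real.smoothTransition.one_of_one_le hz.le
    rw [this.deriv_eq, deriv_const]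
  have hσ0 : ∀ y, y < 0 → deriv Real.smoothTransition y = 0 := fun y hy => by
    have : Real.smoothTransition =ᶠ[𝓝 y] fun _ => (0 : ℝ) := by
      filter_upwards [gt_mem_nhds hy] with z hz
      exact Real.smoothTransition.zero_of_nonpos hz.le
    rw [this.deriv_eq, deriv_const]
  have hcs : HasCompactSupport fun y => deriv Real.smoothTransition (y - 1) := by
    refine HasCompactSupport.intro (isCompact_Icc (a := (1 : ℝ)) (b := 2)) fun y hy => ?_
    rcases lt_or_ge y 1 with h | h
    · exact hσ0 _ (by linarith)
    · refine hσ1 _ ?_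
      by_contra h'
      exact hy ⟨h, by linarith⟩
  have hint : Integrable fun y => deriv Real.smoothTransition (y - 1) :=
    (hσc.comp (continuous_id.sub continuous_const)).integrable_of_hasCompactSupport hcs
  have hone : ∫ y in Ioi (0 : ℝ), deriv Real.smoothTransition (y - 1) = 1 := by
    rw [integral_Ioi_of_hasDerivAt_of_tendsto' (f := fun y => Real.smoothTransition (y - 1))
      (m := 1)]
    · rw [Real.smoothTransition.zero_of_nonpos (by norm_num), sub_zero]
    · intro x _
      exact ((hσ.differentiable (by simp)).differentiableAt.hasDerivAt).comp_sub_const x 1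
    · exact hint.integrableOn
    · refine tendsto_const_nhds.congr' ?_
      filter_upwards [eventually_ge_atTop 2] with y hy
      exact (Real.smoothTransition.one_of_one_le (by linarith)).symm
  -- After the substitution `y = (N+1)x` the kernel vanishes for `y > 2`, and `y/(N+1) ≤ y`, so only
  -- values of `G` on `[0, 2]` matter.
  obtain ⟨K, hK⟩ := isCompact_Icc.exists_bound_of_continuousOn
    (hG.mono (Icc_subset_Ici_self : Icc (0 : ℝ) 2 ⊆ Ici 0))
  have hscale : ∀ N : ℕ, ∫ x in Ioi (0 : ℝ),
      (((N : ℝ) + 1) * deriv Real.smoothTransition (((N : ℝ) + 1) * x - 1)) • G x =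
      ∫ y in Ioi (0 : ℝ), deriv Real.smoothTransition (y - 1) • G (((N : ℝ) + 1)⁻¹ * y) := by
    intro N
    have hN : (0 : ℝ) < (N : ℝ) + 1 := by positivity
    have := integral_comp_mul_left_Ioi
      (fun y => deriv Real.smoothTransition (y - 1) • G (((N : ℝ) + 1)⁻¹ * y)) 0 hN
    rw [mul_zero] at this
    rw [eq_comm, inv_smul_eq_iff₀ hN.ne'] at this
    rw [this, ← integral_smul]
    refine integral_congr_ae (Eventually.of_forall fun x => ?_)
    simp only [mul_smul, inv_mul_cancel_left₀ hN.ne']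
  simp only [hscale]
  have hlim : G 0 = ∫ y in Ioi (0 : ℝ), deriv Real.smoothTransition (y - 1) • G 0 := by
    rw [integral_smul_const, hone, one_smul]
  rw [hlim]
  refine tendsto_integral_of_dominated_convergence
    (fun y => ‖deriv Real.smoothTransition (y - 1)‖ * K) ?_ ?_ ?_ ?_
  · intro N
    refine ContinuousOn.aestronglyMeasurable ?_ measurableSet_Ioi
    refine ContinuousOn.smul (hσc.comp (continuous_id.sub continuous_const)).continuousOn ?_
    refine hG.comp (by fun_prop) fun y hy => ?_
    have : (0 : ℝ) < y := hy
    simp only [mem_Ici]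
    positivity
  · exact (hint.norm.mul_const K).integrableOn
  · intro N
    refine (ae_restrict_iff' measurableSet_Ioi).2 (Eventually.of_forall fun y hy => ?_)
    rw [norm_smul]
    have hy0 : (0 : ℝ) < y := hy
    rcases le_or_gt y 2 with h2 | h2
    · refine mul_le_mul_of_nonneg_left (hK _ ⟨by positivity, ?_⟩) (norm_nonneg _)
      have : ((N : ℝ) + 1)⁻¹ ≤ 1 := inv_le_one_of_one_le₀ (by
        have : (0 : ℝ) ≤ N := Nat.cast_nonneg N
        linarith)
      nlinarith
    · rw [hσ1 _ (by linarith)]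
      simp
  · refine (ae_restrict_iff' measurableSet_Ioi).2 (Eventually.of_forall fun y hy => ?_)
    refine Tendsto.const_smul ?_ _
    have hy0 : (0 : ℝ) < y := hy
    have h1 : Tendsto (fun N : ℕ => ((N : ℝ) + 1)⁻¹ * y) atTop (𝓝[Ici 0] 0) := by
      refine tendsto_nhdsWithin_iff.2 ⟨?_, Eventually.of_forall fun N => ?_⟩
      · have := (tendsto_one_div_add_atTop_nhds_zero_nat (𝕜 := ℝ)).mul_const y
        simpa using this
      · simp only [mem_Ici]
        positivity
    exact (hG 0 self_mem_Ici).tendsto.comp h1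

/-- Integration by parts on the half-line, with the boundary term. -/
theorem integral_deriv_smul_of_hasBoundaryValue {f g : L2Edge} {a : ℂ}
    (h : HasWeakDeriv (Ioi 0) f g) (hb : HasBoundaryValue f a) {φ : ℝ → ℝ} (hφ : ContDiff ℝ ∞ φ)
    (hc : HasCompactSupport φ) :
    ∫ x in Ioi (0 : ℝ), deriv φ x • f x = -(φ 0 • a) - ∫ x in Ioi (0 : ℝ), φ x • g x := by
  obtain ⟨F, hF, hfF, rfl⟩ := hb
  have hσ : ContDiff ℝ ∞ Real.smoothTransition := Real.smoothTransition.contDiff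
  have hσc : Continuous (deriv Real.smoothTransition) := hσ.continuous_deriv (by simp)
  have hφc' : Continuous (deriv φ) := hφ.continuous_deriv (by simp)
  -- This cutoff vanishes for `x ≤ 1/(N+1)` and is `1` for `x ≥ 2/(N+1)`. The shift by `1` keeps its
  -- support away from the vertex, so `η N * φ` is an admissible test function. The term with the
  -- derivative of `η N` concentrates at `0` and yields the boundary term.
  let η : ℕ → ℝ → ℝ := fun N x => Real.smoothTransition (((N : ℝ) + 1) * x - 1)
  have hη : ∀ N, ContDiff ℝ ∞ (η N) := fun N => hσ.comp (by fun_prop)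
  have hηlim : ∀ x ∈ Ioi (0 : ℝ), Tendsto (fun N => η N x) atTop (𝓝 1) := fun x hx => by
    have hx0 : (0 : ℝ) < x := hx
    refine tendsto_const_nhds.congr' ?_
    filter_upwards [eventually_ge_atTop ⌈2 / x⌉₊] with N hN
    have h1 : 2 / x ≤ (N : ℝ) := (Nat.le_ceil _).trans (by exact_mod_cast hN)
    rw [div_le_iff₀ hx0] at h1
    refine (Real.smoothTransition.one_of_one_le ?_).symm
    linarith
  have hη1 : ∀ N x, ‖η N x‖ ≤ 1 := fun N x => by
    rw [Real.norm_of_nonneg (Real.smoothTransition.nonneg _)]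
    exact Real.smoothTransition.le_one _
  have hder : ∀ N x, deriv (fun x => η N x * φ x) x =
      ((N : ℝ) + 1) * deriv Real.smoothTransition (((N : ℝ) + 1) * x - 1) * φ x
        + η N x * deriv φ x := by
    intro N x
    have h1 : HasDerivAt (η N)
        (deriv Real.smoothTransition (((N : ℝ) + 1) * x - 1) * (((N : ℝ) + 1) * 1)) x :=
      HasDerivAt.comp (h₂ := Real.smoothTransition) x
        ((hσ.differentiable (by simp)).differentiableAt.hasDerivAt)
        (((hasDerivAt_id x).const_mul ((N : ℝ) + 1)).sub_const 1)
    have h2 : HasDerivAt (fun x => η N x * φ x) _ x :=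
      h1.mul (hφ.differentiable (by simp)).differentiableAt.hasDerivAt
    rw [h2.deriv]
    ring
  have hmeas : ∀ {ψ : ℝ → ℝ} {u : L2Edge}, Continuous ψ → ∀ N,
      AEStronglyMeasurable (fun x => (η N x * ψ x) • u x) (volume.restrict (Ioi (0 : ℝ))) :=
    fun hψ N => ((hη N).continuous.mul hψ).aestronglyMeasurable.smul (Lp.aestronglyMeasurable _)
  have hcut : ∀ {ψ : ℝ → ℝ} (u : L2Edge), Continuous ψ → HasCompactSupport ψ →
      Tendsto (fun N => ∫ x in Ioi (0 : ℝ), (η N x * ψ x) • u x) atTop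
        (𝓝 (∫ x in Ioi (0 : ℝ), ψ x • u x)) := by
    intro ψ u hψ hψc
    refine tendsto_integral_of_dominated_convergence (fun x => ‖ψ x • u x‖) (hmeas hψ)
      (integrable_test_smul (Lp.memLp u) hψ hψc).norm ?_ ?_
    · intro N
      refine Eventually.of_forall fun x => ?_
      rw [mul_smul, norm_smul]
      exact mul_le_of_le_one_left (norm_nonneg _) (hη1 N x)
    · refine (ae_restrict_iff' measurableSet_Ioi).2 (Eventually.of_forall fun x hx => ?_)
      have := ((hηlim x hx).mul_const (ψ x)).smul_const (u x)
      simpa using this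
  have hsupp : ∀ N, tsupport (fun x => η N x * φ x) ⊆ Ioi 0 := by
    intro N
    have hN : (0 : ℝ) < (N : ℝ) + 1 := by positivity
    have hcl : IsClosed {x : ℝ | 1 ≤ ((N : ℝ) + 1) * x} := isClosed_le (by fun_prop) (by fun_prop)
    refine (closure_minimal (fun x hx => ?_) hcl).trans fun x hx => ?_
    · by_contra hlt
      simp only [mem_ofPred_eq, not_le] at hlt
      refine hx ?_
      simp only [η]
      rw [Real.smoothTransition.zero_of_nonpos (by linarith), zero_mul]
    · have h1 : 1 ≤ ((N : ℝ) + 1) * x := hx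
      exact pos_of_mul_pos_right (by linarith) hN.le
  have hident : ∀ N : ℕ, (∫ x in Ioi (0 : ℝ),
      (((N : ℝ) + 1) * deriv Real.smoothTransition (((N : ℝ) + 1) * x - 1)) • (φ x • F x)) +
      ∫ x in Ioi (0 : ℝ), (η N x * deriv φ x) • f x =
      -∫ x in Ioi (0 : ℝ), (η N x * φ x) • g x := by
    intro N
    have h1 := h (fun x => η N x * φ x) ((hη N).mul hφ) hc.mul_left (hsupp N)
    rw [← h1]
    have e : ∫ x in Ioi (0 : ℝ),
        (((N : ℝ) + 1) * deriv Real.smoothTransition (((N : ℝ) + 1) * x - 1)) • (φ x • F x) =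
        ∫ x in Ioi (0 : ℝ),
        (((N : ℝ) + 1) * deriv Real.smoothTransition (((N : ℝ) + 1) * x - 1) * φ x) • f x := by
      refine integral_congr_ae ?_
      filter_upwards [hfF] with x hx
      rw [hx, smul_smul]
    rw [e, ← integral_add]
    · simp only [hder, add_smul]
    · exact integrable_test_smul (Lp.memLp f) (by fun_prop) hc.mul_left
    · exact integrable_test_smul (Lp.memLp f) ((hη N).continuous.mul hφc') hc.deriv.mul_left
  have hl := (tendsto_integral_deriv_smoothTransition
    (G := fun x => φ x • F x) (hφ.continuous.continuousOn.smul hF)).add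
    (hcut f hφc' hc.deriv)
  simp only [hident] at hl
  have := tendsto_nhds_unique hl (hcut g hφ.continuous hc).neg
  linear_combination this

theorem setIntegral_smul_eq_integral_extendZero (φ : ℝ → ℝ) (f : L2Edge) :
    ∫ x, φ x • extendZero f x = ∫ x in Ioi (0 : ℝ), φ x • f x := by
  rw [← integral_indicator measurableSet_Ioi]
  refine integral_congr_ae ?_
  filter_upwards [coeFn_extendZero f] with x hx
  rw [hx, indicator_smul_apply]

/-- Two functions on the half-line with the same boundary value glue to a weakly differentiable
function on the line. -/
theorem hasWeakDeriv_extendZero_add_reflect {f₁ g₁ f₂ g₂ : L2Edge} {a : ℂ}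
    (h₁ : HasWeakDeriv (Ioi 0) f₁ g₁) (b₁ : HasBoundaryValue f₁ a)
    (h₂ : HasWeakDeriv (Ioi 0) f₂ g₂) (b₂ : HasBoundaryValue f₂ a) :
    HasWeakDeriv univ (extendZero f₁ + reflect (extendZero f₂) : L2Line)
      (extendZero g₁ - reflect (extendZero g₂) : L2Line) := by
  intro φ k1 k2 _
  rw [Measure.restrict_univ]
  have k1' : ContDiff ℝ ∞ fun x => φ (-x) := k1.comp contDiff_neg
  have k2' : HasCompactSupport fun x => φ (-x) := k2.comp_homeomorph (Homeomorph.neg ℝ)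
  have hi : ∀ {ψ : ℝ → ℝ} (u : L2Line), Continuous ψ → HasCompactSupport ψ →
      Integrable (fun x => ψ x • u x) volume := fun u hψ hψc => by
    simpa using integrable_test_smul ((Lp.memLp u).restrict univ) hψ hψc
  have c' : Continuous (deriv φ) := k1.continuous_deriv (by simp)
  have e1 : ∫ x, deriv φ x • (extendZero f₁ + reflect (extendZero f₂) : L2Line) x =
      (∫ x, deriv φ x • extendZero f₁ x) + ∫ x, deriv φ x • reflect (extendZero f₂) x := by
    rw [← integral_add (hi _ c' k2.deriv) (hi _ c' k2.deriv)]
    refine integral_congr_ae ?_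
    filter_upwards [Lp.coeFn_add (extendZero f₁) (reflect (extendZero f₂))] with x hx
    rw [hx, Pi.add_apply, smul_add]
  have e2 : ∫ x, φ x • (extendZero g₁ - reflect (extendZero g₂) : L2Line) x =
      (∫ x, φ x • extendZero g₁ x) - ∫ x, φ x • reflect (extendZero g₂) x := by
    rw [← integral_sub (hi _ k1.continuous k2) (hi _ k1.continuous k2)]
    refine integral_congr_ae ?_
    filter_upwards [Lp.coeFn_sub (extendZero g₁) (reflect (extendZero g₂))] with x hx
    rw [hx, Pi.sub_apply, smul_sub]
  -- The two half-lines contribute the boundary terms `-φ(0) a` and `+φ(0) a`, which cancel because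
  -- the boundary values agree.
  rw [e1, e2, integral_deriv_smul_reflect, integral_smul_reflect,
    setIntegral_smul_eq_integral_extendZero, setIntegral_smul_eq_integral_extendZero,
    setIntegral_smul_eq_integral_extendZero, setIntegral_smul_eq_integral_extendZero,
    integral_deriv_smul_of_hasBoundaryValue h₁ b₁ k1 k2,
    integral_deriv_smul_of_hasBoundaryValue h₂ b₂ k1' k2', neg_zero]
  ring_nf

/-- The triples `(f, f', f(0))` with `f ∈ W^{1,2}(0, ∞)`. -/
def traceGraph : Submodule ℂ (L2Edge × L2Edge × ℂ) where
  carrier := {p | HasWeakDeriv (Ioi 0) p.1 p.2.1 ∧ HasBoundaryValue p.1 p.2.2}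
  add_mem' := by
    rintro ⟨f, g, a⟩ ⟨f₁, g₁, a₁⟩ ⟨h1, h2⟩ ⟨k1, k2⟩
    exact ⟨(h1.add (Lp.memLp _) (Lp.memLp _) (Lp.memLp _) (Lp.memLp _) k1).congr
      (Lp.coeFn_add _ _) (Lp.coeFn_add _ _), h2.add k2⟩
  zero_mem' := ⟨(HasWeakDeriv.zero _).congr (Lp.coeFn_zero _ _ _) (Lp.coeFn_zero _ _ _),
    HasBoundaryValue.zero⟩
  smul_mem' := by
    rintro c ⟨f, g, a⟩ ⟨h1, h2⟩
    exact ⟨(h1.const_smul c).congr (Lp.coeFn_smul _ _) (Lp.coeFn_smul _ _), h2.const_smul c⟩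

end Gluing

/-! ### The reflection principle for the star graph -/

section Star

variable {n : ℕ} {S : Matrix (Fin n) (Fin n) ℂ}

/-- The extension of a function on the star graph to `n` functions on the line, by the
reflection rule `f (-x) = S f (x)`. -/
def unfold (S : Matrix (Fin n) (Fin n) ℂ) : L2Star n →L[ℂ] (Fin n → L2Line) :=
  ContinuousLinearMap.pi fun j =>
    extendZeroₗᵢ.toContinuousLinearMap ∘L PiLp.proj 2 (fun _ : Fin n => L2Edge) j +
      reflect.toContinuousLinearMap ∘L extendZeroₗᵢ.toContinuousLinearMap ∘L
        ∑ k, S j k • PiLp.proj 2 (fun _ : Fin n => L2Edge) k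

theorem unfold_apply (S : Matrix (Fin n) (Fin n) ℂ) (f : L2Star n) (j : Fin n) :
    unfold S f j = extendZero (f j) + reflect (extendZero (∑ k, S j k • f k)) := by
  simp only [← extendZeroₗᵢ_apply, map_sum, map_smul]
  simp [unfold]

/-- The restriction to the positive half-lines. -/
def restrictStar : (Fin n → L2Line) →L[ℂ] L2Star n :=
  ((PiLp.continuousLinearEquiv 2 ℂ fun _ : Fin n => L2Edge).symm :
      (Fin n → L2Edge) →L[ℂ] L2Star n) ∘L
    ContinuousLinearMap.pi fun j => restrictEdgeL ∘L ContinuousLinearMap.proj j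

theorem restrictStar_apply (g : Fin n → L2Line) (j : Fin n) :
    restrictStar g j = restrictEdge (g j) := rfl

theorem restrictEdge_unfold (S : Matrix (Fin n) (Fin n) ℂ) (f : L2Star n) (j : Fin n) :
    restrictEdge (unfold S f j) = f j := by
  rw [unfold_apply, ← restrictEdgeL_apply, map_add, restrictEdgeL_apply, restrictEdgeL_apply,
    restrictEdge_extendZero, restrictEdge_reflect_extendZero, add_zero]

theorem restrictStar_unfold (S : Matrix (Fin n) (Fin n) ℂ) (f : L2Star n) :
    restrictStar (unfold S f) = f := by
  ext1 j
  rw [restrictStar_apply, restrictEdge_unfold]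

theorem sum_smul_sum_smul {M : Type*} [AddCommGroup M] [Module ℂ M] (hS : S * S = 1)
    (f : Fin n → M) (j : Fin n) : ∑ k, S j k • ∑ l, S k l • f l = f j := by
  simp only [Finset.smul_sum, smul_smul]
  rw [Finset.sum_comm]
  simp only [← Finset.sum_smul, ← Matrix.mul_apply, hS, Matrix.one_apply]
  simp

/-- Swapping the half-lines puts `S f` on the right and `f` on the left, and `f = S (S f)`; this is
where `S² = 1` enters. -/
theorem reflect_unfold (hS : S * S = 1) (f : L2Star n) (j : Fin n) :
    reflect (unfold S f j) = ∑ k, S j k • unfold S f k := by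
  simp only [unfold_apply, smul_add, Finset.sum_add_distrib, ← extendZeroₗᵢ_apply, ← map_smul,
    ← map_sum, sum_smul_sum_smul hS, map_add, reflect_reflect]
  rw [add_comm]

/-- Together with `reflect_unfold` this identifies the range of `unfold S` as the functions obeying
the reflection rule. -/
theorem unfold_restrictStar {g : Fin n → L2Line}
    (hg : ∀ j, reflect (g j) = ∑ k, S j k • g k) : unfold S (restrictStar g) = g := by
  funext j
  rw [unfold_apply]
  have : ∑ k, S j k • restrictStar g k = restrictEdge (reflect (g j)) := by
    rw [hg, ← restrictEdgeL_apply]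
    simp only [map_sum, map_smul]
    rfl
  rw [this, restrictStar_apply, extendZero_add_reflect]

theorem sum_norm_sq_sum_smul {M : Type*} [NormedAddCommGroup M] [InnerProductSpace ℂ M]
    (hS : Sᴴ * S = 1) (f : Fin n → M) :
    ∑ j, ‖∑ k, S j k • f k‖ ^ 2 = ∑ j, ‖f j‖ ^ 2 := by
  have h : ∑ j, inner ℂ (∑ k, S j k • f k) (∑ l, S j l • f l) = ∑ j, inner ℂ (f j) (f j) := by
    simp only [sum_inner, inner_sum, inner_smul_left, inner_smul_right, Finset.mul_sum]
    rw [Finset.sum_comm]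
    refine Finset.sum_congr rfl fun l _ => ?_
    rw [Finset.sum_comm]
    have : ∀ k, ∑ j, S j l * ((starRingEnd ℂ) (S j k) * inner ℂ (f k) (f l)) =
        (Sᴴ * S) k l * inner ℂ (f k) (f l) := fun k => by
      rw [Matrix.mul_apply, Finset.sum_mul]
      refine Finset.sum_congr rfl fun j _ => ?_
      rw [Matrix.conjTranspose_apply, Complex.star_def]
      ring
    simp [this, hS, Matrix.one_apply]
  simp only [inner_self_eq_norm_sq_to_K] at h
  exact_mod_cast h

/-- Up to the factor `√2` unfolding is isometric, as `S` is unitary. The sum of squares is written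
out because `Fin n → L2Line` carries the supremum norm. -/
theorem sum_norm_sq_unfold (hS : Sᴴ * S = 1) (f : L2Star n) :
    ∑ j, ‖unfold S f j‖ ^ 2 = 2 * ‖f‖ ^ 2 := by
  simp only [unfold_apply, norm_sq_extendZero_add_reflect, Finset.sum_add_distrib,
    sum_norm_sq_sum_smul hS]
  rw [PiLp.norm_sq_eq_of_L2]
  ring

/-- The free group on `n` copies of the line. -/
def freeGroupPi (t : ℝ) : (Fin n → L2Line) →L[ℂ] (Fin n → L2Line) :=
  ContinuousLinearMap.pi fun j => freeGroup t ∘L ContinuousLinearMap.proj j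

theorem freeGroupPi_apply (t : ℝ) (g : Fin n → L2Line) (j : Fin n) :
    freeGroupPi t g j = freeGroup t (g j) := rfl

/-- The group `e^{-itH⋆}`, by the reflection principle. -/
def reflectedGroup (S : Matrix (Fin n) (Fin n) ℂ) (t : ℝ) : L2Star n →L[ℂ] L2Star n :=
  restrictStar ∘L freeGroupPi t ∘L unfold S

theorem reflectedGroup_apply (t : ℝ) (f : L2Star n) :
    reflectedGroup S t f = restrictStar (freeGroupPi t (unfold S f)) := rfl

/-- The free evolution stays in the range of `unfold S`: it commutes with reflections and, being
linear and the same on all copies, with the mixing by `S`. -/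
theorem unfold_reflectedGroup (hS : S * S = 1) (t : ℝ) (f : L2Star n) :
    unfold S (reflectedGroup S t f) = freeGroupPi t (unfold S f) := by
  rw [reflectedGroup_apply]
  refine unfold_restrictStar fun j => ?_
  simp only [freeGroupPi_apply]
  rw [← freeGroup_reflect, reflect_unfold hS, map_sum]
  simp only [map_smul]

/-- Differentiating `f(-x) = S f(x)` gives `f'(-x) = -S f'(x)`, hence the change of sign; `S a = a`
says that the two sides match at the vertex. -/
theorem hasWeakDeriv_unfold {f g : L2Star n} {a : Fin n → ℂ} (h : IsDeriv f g)
    (ha : IsVertexValue f a) (hS : S *ᵥ a = a) (j : Fin n) :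
    HasWeakDeriv univ (unfold S f j) (unfold (-S) g j) := by
  -- Working with triples shows at once that the `j`-th component of `S f` is weakly differentiable
  -- and has boundary value `(S a) j = a j`.
  have hsum : ∑ k, S j k • ((f k, g k, a k) : L2Edge × L2Edge × ℂ) ∈ traceGraph :=
    traceGraph.sum_mem fun k _ => traceGraph.smul_mem _ ⟨h k, ha k⟩
  have e : ∑ k, S j k • ((f k, g k, a k) : L2Edge × L2Edge × ℂ) =
      (∑ k, S j k • f k, ∑ k, S j k • g k, a j) := by
    refine Prod.ext ?_ (Prod.ext ?_ ?_)
    · simp [Prod.fst_sum]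
    · simp [Prod.fst_sum, Prod.snd_sum]
    · have := congrFun hS j
      simpa [Prod.snd_sum, Matrix.mulVec, dotProduct] using this
  rw [e] at hsum
  have := hasWeakDeriv_extendZero_add_reflect (h j) (ha j) hsum.1 hsum.2
  have e2 : unfold (-S) g j = extendZero (g j) - reflect (extendZero (∑ k, S j k • g k)) := by
    rw [unfold_apply, sub_eq_add_neg]
    simp only [Matrix.neg_apply, neg_smul, Finset.sum_neg_distrib, ← extendZeroₗᵢ_apply, map_neg]
  rw [e2, unfold_apply]
  exact this

/-- For continuous representatives the reflection rule holds at every point, and at `x = 0` it is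
the vertex condition. -/
theorem mulVec_eq_self_of_reflect {g : Fin n → L2Line}
    (hg : ∀ j, reflect (g j) = ∑ k, S j k • g k) {F : Fin n → ℝ → ℂ} (hF : ∀ j, Continuous (F j))
    (hgF : ∀ j, g j =ᵐ[volume] F j) : (S *ᵥ fun j => F j 0) = fun j => F j 0 := by
  funext j
  have h1 : (fun x => F j (-x)) =ᵐ[volume] fun x => ∑ k, S j k * F k x := by
    have h2 : (∑ k, S j k • g k : L2Line) =ᵐ[volume] fun x => ∑ k, S j k * F k x := by
      have hs := Lp.coeFn_finsetSum Finset.univ fun k => S j k • g k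
      have hall : ∀ᵐ x : ℝ, ∀ k, (S j k • g k : L2Line) x = S j k * F k x := by
        rw [ae_all_iff]
        intro k
        filter_upwards [Lp.coeFn_smul (S j k) (g k), hgF k] with x k1 k2
        rw [k1, Pi.smul_apply, k2, smul_eq_mul]
      filter_upwards [hs, hall] with x k1 k2
      rw [k1, Finset.sum_apply]
      exact Finset.sum_congr rfl fun k _ => k2 k
    rw [← hg] at h2
    filter_upwards [h2, coeFn_reflect (g j), ae_comp_neg (hgF j)] with x k1 k2 k3
    rw [← k3, ← k2, k1]
  have h3 := (Continuous.ae_eq_iff_eq (volume : Measure ℝ) ((hF j).comp continuous_neg)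
    (continuous_finsetSum _ fun k _ => continuous_const.mul (hF k))).1 h1
  have := congrFun h3 0
  simp only [Function.comp_apply, neg_zero] at this
  exact this.symm

variable {A B : Matrix (Fin n) (Fin n) ℂ}

/-- The reflection principle: the Hamiltonian corresponds to the free Laplacian on the line. -/
theorem mem_hamiltonianGraph_iff (hS : S * S = 1)
    (hc : ∀ F F' : Fin n → ℂ, A *ᵥ F + B *ᵥ F' = 0 ↔ S *ᵥ F = F ∧ -S *ᵥ F' = F')
    (f g : L2Star n) :
    (f, g) ∈ hamiltonianGraph A B ↔ ∀ j, (unfold S f j, -unfold S g j) ∈ laplacianLineGraph := by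
  constructor
  · rintro ⟨f', a, b, h1, h2, h3, h4, h5⟩ j
    obtain ⟨ha, hb⟩ := (hc a b).1 h5
    refine ⟨unfold (-S) f' j, hasWeakDeriv_unfold h1 h3 ha j, ?_⟩
    have := hasWeakDeriv_unfold h2 h4 hb j
    rwa [neg_neg, map_neg] at this
  · intro h
    choose k h1 h2 using h
    replace h1 : ∀ j, HasWeakDeriv univ (unfold S f j) (k j) := h1
    replace h2 : ∀ j, HasWeakDeriv univ (k j) (-unfold S g j : L2Line) := h2
    -- Differentiating the rule for `unfold S f` and using uniqueness of the weak derivative gives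
    -- the rule with `-S`, which will provide the condition on `f'(0)`.
    have hk : ∀ j, reflect (k j) = ∑ l, (-S) j l • k l := by
      intro j
      have hsum : ∑ l, S j l • ((unfold S f l, k l) : L2Line × L2Line) ∈ derivLineGraph :=
        derivLineGraph.sum_mem fun l _ => derivLineGraph.smul_mem _ (h1 l)
      have e : ∑ l, S j l • ((unfold S f l, k l) : L2Line × L2Line) =
          (∑ l, S j l • unfold S f l, ∑ l, S j l • k l) := by
        refine Prod.ext ?_ ?_ <;> simp [Prod.fst_sum, Prod.snd_sum]
      rw [e, mem_derivLineGraph, ← reflect_unfold hS] at hsum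
      have := (h1 j).reflect.unique_line hsum
      simp only [Matrix.neg_apply, neg_smul, Finset.sum_neg_distrib]
      rw [← this, neg_neg]
    choose F hF hfF using fun j => (h1 j).exists_continuous
    choose G hG hkG using fun j => (h2 j).exists_continuous
    refine ⟨restrictStar k, fun j => F j 0, fun j => G j 0, fun j => ?_, fun j => ?_, fun j => ?_,
      fun j => ?_, (hc _ _).2 ⟨mulVec_eq_self_of_reflect (reflect_unfold hS f) hF hfF,
        mulVec_eq_self_of_reflect hk hG hkG⟩⟩
    · have := (h1 j).restrictEdge
      rwa [restrictEdge_unfold] at this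
    · have := (h2 j).restrictEdge
      rw [← restrictEdgeL_apply (-_), map_neg, restrictEdgeL_apply, restrictEdge_unfold] at this
      exact this
    · refine ⟨F j, (hF j).continuousOn, ?_, rfl⟩
      have := (coeFn_restrictEdge (unfold S f j)).trans (ae_restrict_of_ae (hfF j))
      rwa [restrictEdge_unfold] at this
    · exact ⟨G j, (hG j).continuousOn,
        (coeFn_restrictEdge (k j)).trans (ae_restrict_of_ae (hkG j)), rfl⟩

/-- Unfolding and restricting are bounded and intertwine the two evolutions, so difference quotients
may be compared on either side. -/
theorem hasSlopeLimit_reflectedGroup_iff (hS : S * S = 1) (f g : L2Star n) :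
    HasSlopeLimit (fun t => reflectedGroup S t f) g ↔
      ∀ j, HasSlopeLimit (fun t => freeGroup t (unfold S f j)) (unfold S g j) := by
  have hpi : HasSlopeLimit (fun t => freeGroupPi t (unfold S f)) (unfold S g) ↔
      ∀ j, HasSlopeLimit (fun t => freeGroup t (unfold S f j)) (unfold S g j) := tendsto_pi_nhds
  rw [← hpi]
  constructor
  · intro h
    have := h.map (unfold S)
    simpa only [unfold_reflectedGroup hS] using this
  · intro h
    have := h.map restrictStar
    rwa [restrictStar_unfold] at this

theorem isGroupGeneratedBy_reflectedGroup (hS : S * S = 1) (hS' : Sᴴ * S = 1)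
    (hc : ∀ F F' : Fin n → ℂ, A *ᵥ F + B *ᵥ F' = 0 ↔ S *ᵥ F = F ∧ -S *ᵥ F' = F') :
    IsGroupGeneratedBy (reflectedGroup S) ((-Complex.I) • hamiltonian A B) where
  map_zero := by
    ext1 f
    have : freeGroupPi 0 (unfold S f) = unfold S f := by
      funext j
      rw [freeGroupPi_apply, isGroupGeneratedBy_freeGroup.map_zero]
      rfl
    rw [reflectedGroup_apply, this, restrictStar_unfold]
    rfl
  map_add s t := by
    ext1 f
    change reflectedGroup S (s + t) f = reflectedGroup S s (reflectedGroup S t f)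
    rw [reflectedGroup_apply, reflectedGroup_apply s, unfold_reflectedGroup hS]
    congr 1
    funext j
    exact isGroupGeneratedBy_freeGroup.add_apply s t _
  norm_map t f := by
    have h1 := sum_norm_sq_unfold hS' (reflectedGroup S t f)
    rw [unfold_reflectedGroup hS] at h1
    simp only [freeGroupPi_apply, isGroupGeneratedBy_freeGroup.norm_map] at h1
    rw [sum_norm_sq_unfold hS' f] at h1
    exact ((sq_eq_sq₀ (norm_nonneg _) (norm_nonneg _)).1 (by linarith)).symm
  continuous f := restrictStar.continuous.comp
    (continuous_pi fun j => isGroupGeneratedBy_freeGroup.continuous (unfold S f j))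
  generator f g := by
    rw [mem_smul_graph_iff _ (neg_ne_zero.2 Complex.I_ne_zero), hamiltonian_graph,
      mem_hamiltonianGraph_iff hS hc, ← hasSlopeLimit_iff_hasDerivAt,
      hasSlopeLimit_reflectedGroup_iff hS]
    refine forall_congr' fun j => ?_
    rw [hasSlopeLimit_iff_hasDerivAt, ← isGroupGeneratedBy_freeGroup.generator,
      mem_smul_graph_iff _ Complex.I_ne_zero, laplacianLine_graph, map_smul, Pi.smul_apply,
      inv_neg, neg_smul, neg_neg]

theorem eigenfunctions_hamiltonian_eq_empty (hS : S * S = 1)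
    (hc : ∀ F F' : Fin n → ℂ, A *ᵥ F + B *ᵥ F' = 0 ↔ S *ᵥ F = F ∧ -S *ᵥ F' = F') :
    eigenfunctions (hamiltonian A B) = ∅ := by
  refine eq_empty_of_forall_notMem fun f hf => ?_
  obtain ⟨hf0, lam, h⟩ := hf
  rw [hamiltonian_graph, mem_hamiltonianGraph_iff hS hc] at h
  refine hf0 ?_
  have : unfold S f = 0 := funext fun j => by
    have h1 := h j
    rw [map_smul, Pi.smul_apply, ← neg_smul] at h1
    exact eq_zero_of_mem_laplacianLineGraph h1
  rw [← restrictStar_unfold S f, this, map_zero]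

theorem projC_eq_one {E : Type*} [NormedAddCommGroup E] [InnerProductSpace ℂ E] [CompleteSpace E]
    {T : E →ₗ.[ℂ] E} (h : eigenfunctions T = ∅) : projC T = 1 := by
  have h1 : (Submodule.span ℂ (eigenfunctions T)).topologicalClosure = ⊥ := by
    rw [h, Submodule.span_empty]
    exact IsClosed.submodule_topologicalClosure_eq (by simp)
  ext1 f
  simp [projC, h1]

/-- The derivative of the evolution, by the reflection principle. -/
theorem isDeriv_reflectedGroup {v v' : L2Star n} {a : Fin n → ℂ} (h : IsDeriv v v')
    (ha : IsVertexValue v a) (hSa : S *ᵥ a = a) (t : ℝ) :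
    IsDeriv (reflectedGroup S t v)
      (-(reflectedGroup S t v') + (2 : ℂ) • freeGroupOnEdges t v') := by
  intro j
  have h1 := ((hasWeakDeriv_unfold h ha hSa j).freeGroup t).restrictEdge
  -- The reflected halves of the `S`- and `-S`-extensions cancel in the sum, while the halves on
  -- `(0, ∞)` add up; this is the source of the factor `2`.
  have e : unfold (-S) v' j = -unfold S v' j + (2 : ℂ) • extendZero (v' j) := by
    rw [unfold_apply, unfold_apply]
    simp only [Matrix.neg_apply, neg_smul, Finset.sum_neg_distrib, ← extendZeroₗᵢ_apply, map_neg]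
    rw [two_smul]
    abel
  rw [e, map_add, map_neg, map_smul, ← restrictEdgeL_apply (_ + _), map_add, map_neg,
    map_smul] at h1
  exact h1

/-! ### Vertex conditions without Robin part -/

theorem CouplingParts.PD_add_PN (C : CouplingParts A B) (hR : C.PR = 0) : C.PD + C.PN = 1 := by
  have := C.sum_eq
  rw [hR] at this
  linear_combination (norm := noncomm_ring) this

theorem CouplingParts.PN_mul_PD (C : CouplingParts A B) : C.PN * C.PD = 0 := by
  have := congrArg star C.orthDN
  rwa [star_mul, C.projD.isSelfAdjoint.star_eq, C.projN.isSelfAdjoint.star_eq, star_zero] at this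

/-- Without Robin coupling, the vertex condition is a condition on the eigenspaces of the
reflection `P_N - P_D`. -/
theorem CouplingParts.coupling_iff (C : CouplingParts A B) (hR : C.PR = 0) (F F' : Fin n → ℂ) :
    A *ᵥ F + B *ᵥ F' = 0 ↔ (C.PN - C.PD) *ᵥ F = F ∧ -(C.PN - C.PD) *ᵥ F' = F' := by
  have hs : ∀ x : Fin n → ℂ, x = C.PD *ᵥ x + C.PN *ᵥ x := fun x => by
    rw [← Matrix.add_mulVec, C.PD_add_PN hR, Matrix.one_mulVec]
  -- If `x = y + z`, then `z - y = x` means `2y = 0`. It is used with `y = P_D F` and then with `y =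
  -- P_N F'`.
  have key : ∀ (x y z : Fin n → ℂ), x = y + z → (z - y = x ↔ y = 0) := by
    intro x y z hx
    rw [hx]
    constructor
    · intro h
      have h2 : (2 : ℂ) • y = 0 := by
        rw [two_smul]
        linear_combination (norm := module) -h
      exact (smul_eq_zero.1 h2).resolve_left two_ne_zero
    · rintro rfl
      simp
  rw [C.coupling, hR, neg_sub, Matrix.sub_mulVec, Matrix.sub_mulVec, key F _ _ (hs F),
    key F' _ _ ((hs F').trans (add_comm _ _))]
  simp

/-- The pairs `(P_N x, 0)` and `(0, P_D x)` satisfy the coupling condition, so `A P_N = 0` and `B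
P_D = 0`. Inserting `1 = P_D + P_N` between the factors of `A Bᴴ` kills both terms. -/
theorem CouplingParts.mul_conjTranspose_eq_zero (C : CouplingParts A B) (hR : C.PR = 0) :
    A * Bᴴ = 0 := by
  have hA : A * C.PN = 0 := by
    refine Matrix.ext_of_mulVec_single fun i => ?_
    have := (C.coupling (C.PN *ᵥ Pi.single i 1) 0).2
      ⟨by rw [Matrix.mulVec_mulVec, C.orthDN, Matrix.zero_mulVec], by simp, by simp [hR]⟩
    rw [Matrix.mulVec_zero, add_zero, Matrix.mulVec_mulVec] at this
    rw [this, Matrix.zero_mulVec]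
  have hB : B * C.PD = 0 := by
    refine Matrix.ext_of_mulVec_single fun i => ?_
    have := (C.coupling 0 (C.PD *ᵥ Pi.single i 1)).2
      ⟨by simp, by rw [Matrix.mulVec_mulVec, C.PN_mul_PD, Matrix.zero_mulVec], by simp [hR]⟩
    rw [Matrix.mulVec_zero, zero_add, Matrix.mulVec_mulVec] at this
    rw [this, Matrix.zero_mulVec]
  have hB' : C.PD * Bᴴ = 0 := by
    have := congrArg star hB
    rw [star_mul, C.projD.isSelfAdjoint.star_eq, star_zero] at this
    exact this
  calc A * Bᴴ = A * (C.PD + C.PN) * Bᴴ := by rw [C.PD_add_PN hR, mul_one]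
    _ = A * (C.PD * Bᴴ) + A * C.PN * Bᴴ := by noncomm_ring
    _ = 0 := by rw [hB', hA]; simp

theorem CouplingParts.reflection_mul_self (C : CouplingParts A B) (hR : C.PR = 0) :
    (C.PN - C.PD) * (C.PN - C.PD) = 1 := by
  rw [mul_sub, sub_mul, sub_mul, C.projN.isIdempotentElem.eq, C.projD.isIdempotentElem.eq,
    C.orthDN, C.PN_mul_PD, ← C.PD_add_PN hR]
  abel

theorem CouplingParts.reflection_conjTranspose (C : CouplingParts A B) :
    (C.PN - C.PD)ᴴ = C.PN - C.PD := by
  rw [← Matrix.star_eq_conjTranspose, star_sub, C.projD.isSelfAdjoint.star_eq,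
    C.projN.isSelfAdjoint.star_eq]

theorem numPosEigenvalues_eq_zero {M : Matrix (Fin n) (Fin n) ℂ} (hM : M.IsHermitian)
    (h : M = 0) : numPosEigenvalues hM = 0 := by
  have h1 := hM.eigenvalues_eq_zero_iff.2 h
  simp [numPosEigenvalues, h1]

end Star

end StarGraph

end


/-- The first two conjuncts ensure that `starGroup` and `freeGroup` are the genuine groups and not
the default value `0` of `expGroup`. The third ensures that the final statement about all complete
lists of eigencouples is not vacuous. -/
theorem proposition2p15 {n : ℕ} (hn : 1 ≤ n) (A B : Matrix (Fin n) (Fin n) ℂ)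
    (hrank : (Matrix.fromCols A B).rank = n) (hAB : (A * Bᴴ).IsHermitian)
    (C : StarGraph.CouplingParts A B) (hR : C.PR = 0) :
    StarGraph.IsGroupGeneratedBy (StarGraph.starGroup A B)
        ((-Complex.I) • StarGraph.hamiltonian A B) ∧
      StarGraph.IsGroupGeneratedBy StarGraph.freeGroup (Complex.I • StarGraph.laplacianLine) ∧
      (∃ (lam : Fin (StarGraph.numPosEigenvalues hAB) → ℝ)
          (φ φ' : Fin (StarGraph.numPosEigenvalues hAB) → StarGraph.L2Star n),
        StarGraph.IsEigencouples (StarGraph.hamiltonian A B) lam φ ∧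
          ∀ l, StarGraph.IsDeriv (φ l) (φ' l)) ∧
      ∀ (lam : Fin (StarGraph.numPosEigenvalues hAB) → ℝ)
        (φ φ' : Fin (StarGraph.numPosEigenvalues hAB) → StarGraph.L2Star n),
        StarGraph.IsEigencouples (StarGraph.hamiltonian A B) lam φ →
        (∀ l, StarGraph.IsDeriv (φ l) (φ' l)) →
        ∀ v ∈ StarGraph.formDomain C.PD, ∀ v' : StarGraph.L2Star n, StarGraph.IsDeriv v v' →
          ∀ t : ℝ, StarGraph.IsDeriv (StarGraph.starGroup A B t v)
            (-(StarGraph.starGroup A B t (StarGraph.projC (StarGraph.hamiltonian A B) v'))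
              + (2 : ℂ) • StarGraph.freeGroupOnEdges t v'
              + ∑ l, (inner ℂ (φ l) v * Complex.exp (-Complex.I * t * lam l)) • φ' l) := by
  have hS := C.reflection_mul_self hR
  have hS' : (C.PN - C.PD)ᴴ * (C.PN - C.PD) = 1 := by rw [C.reflection_conjTranspose, hS]
  have hc := C.coupling_iff hR
  have hU := StarGraph.isGroupGeneratedBy_reflectedGroup hS hS' hc
  have hempty := StarGraph.eigenfunctions_hamiltonian_eq_empty hS hc
  have : IsEmpty (Fin (StarGraph.numPosEigenvalues hAB)) := by
    rw [StarGraph.numPosEigenvalues_eq_zero hAB (C.mul_conjTranspose_eq_zero hR)]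
    infer_instance
  refine ⟨StarGraph.isGroupGeneratedBy_expGroup hU, StarGraph.isGroupGeneratedBy_freeGroup,
    ⟨isEmptyElim, isEmptyElim, isEmptyElim, ⟨⟨isEmptyElim, isEmptyElim⟩, isEmptyElim, ?_⟩,
      isEmptyElim⟩, ?_⟩
  · rw [hempty]
    exact Set.empty_subset _
  · rintro lam φ φ' - - v ⟨-, a, ha, hPD⟩ v' hv t
    -- Only `P_D v(0) = 0` is known. Pairing `a` with `F' = 0` makes the other coupling conditions
    -- trivial, so the equivalence for `S` applies.
    have hSa : (C.PN - C.PD) *ᵥ a = a := ((hc a 0).1 ((C.coupling a 0).2 (by simp [hPD, hR]))).1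
    rw [StarGraph.starGroup, StarGraph.expGroup_eq hU, StarGraph.projC_eq_one hempty,
      Finset.univ_eq_empty, Finset.sum_empty, add_zero]
    exact StarGraph.isDeriv_reflectedGroup hv ha hSa t
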